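/- For $n\ge 2$ let $T_n$ be the twin group, i.e. the group with generators $s_1,\dots,s_{n-1}$ and defining relations $s_i^2=1$ for all $i$ and $s_is_j=s_js_i$ whenever $|i-j|\ge 2$. Write $\operatorname{Inn}(T_n)$ for the group of inner automorphisms of $T_n$ and $\operatorname{Out}(T_n)=\operatorname{Aut}(T_n)/\operatorname{Inn}(T_n)$. Then the following hold. (0) For $n\ge 3$, an automorphism $f$ of $T_n$ is inner if and only if $f(s_i)$ is conjugate to $s_i$ in $T_n$ for every $1\le i\le n-1$. For $n\ge 3$ there is an automorphism $\psi$ of $T_n$ with $\psi(s_i)=s_{n-i}$ for $1\le i\le n-1$. There is an automorphism $\tau$ of $T_4$ with $\tau(s_1)=s_1s_3$, $\tau(s_2)=s_2$, $\tau(s_3)=s_1$. For $n\ge 5$ there is an automorphism $\kappa$ of $T_n$ with $\kappa(s_3)=s_{n-3}s_{n-1}$ and $\kappa(s_i)=s_{n-i}$ for all $1\le i\le n-1$ with $i\ne 3$. Put $$(H_3,D_3)=(\langle\psi\rangle,\mathbb Z_2),\qquad (H_4,D_4)=(\langle\psi,\tau\rangle,S_3),\qquad (H_n,D_n)=(\langle\psi,\kappa\rangle,D_8)\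 \ (n\ge 5),$$ where $D_8$ is the dihedral group of order $8$. Then for every $n\ge 3$: (1) $\operatorname{Aut}(T_n)\cong T_n\rtimes D_n$, that is, $\operatorname{Aut}(T_3)\cong T_3\rtimes\mathbb Z_2$, $\operatorname{Aut}(T_4)\cong T_4\rtimes S_3$ and $\operatorname{Aut}(T_n)\cong T_n\rtimes D_8$ for $n\ge 5$. More precisely, there are a homomorphism $\varphi:D_n\to\operatorname{Aut}(T_n)$ with image $H_n$ and an isomorphism $T_n\rtimes_\varphi D_n\to\operatorname{Aut}(T_n)$ that sends $g\in T_n$ to conjugation by $g$ and $d\in D_n$ to $\varphi(d)$. (2) $\operatorname{Out}(T_n)\cong D_n\cong H_n$, and the quotient map $\operatorname{Aut}(T_n)\to\operatorname{Out}(T_n)$ restricts to an isomorphism $H_n\to\operatorname{Out}(T_n)$. In particular $\operatorname{Out}(T_n)$ is generated by the class of $\psi$ if $n=3$, by the classes of $\psi,\tau$ if $n=4$, and by the classes of $\psi,\kappa$ if $n\ge 5$. -/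

import Mathlib

/-- The index set `{1, …, n - 1}` of the generators of the twin group `T_n`. -/
abbrev TwinIndex (n : ℕ) : Type := {i : ℕ // 1 ≤ i ∧ i < n}

/-- The defining relators of the twin group: `s_i ^ 2` for all `i`, and `s_i s_j (s_j s_i)⁻¹`
whenever `|i - j| ≥ 2`. -/
def twinRelators (n : ℕ) : Set (FreeGroup (TwinIndex n)) :=
  {r | ∃ i : TwinIndex n, r = FreeGroup.of i ^ 2} ∪
  {r | ∃ i j : TwinIndex n, 2 ≤ |((i : ℕ) : ℤ) - ((j : ℕ) : ℤ)| ∧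
    r = (FreeGroup.of i * FreeGroup.of j) * (FreeGroup.of j * FreeGroup.of i)⁻¹}

/-- The twin group `T_n`. -/
abbrev TwinGroup (n : ℕ) : Type := PresentedGroup (twinRelators n)

/-- The generator `s_i` of `T_n`, for `1 ≤ i ≤ n - 1`. Outside this range the value is `1`;
it is never used there. -/
def twinGen (n i : ℕ) : TwinGroup n :=
  if h : 1 ≤ i ∧ i < n then PresentedGroup.of (⟨i, h⟩ : TwinIndex n) else 1

/-- The group `Inn(G)` of inner automorphisms, as a subgroup of `Aut(G)`. -/
abbrev InnerAut (G : Type*) [Group G] : Subgroup (MulAut G) :=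
  (MulAut.conj : G →* MulAut G).range

instance InnerAut.normal (G : Type*) [Group G] : (InnerAut G).Normal where
  conj_mem := by
    rintro _ ⟨g, rfl⟩ f
    refine ⟨f g, ?_⟩
    ext x
    simp [MulAut.mul_apply, MulAut.conj_apply]

/-- The outer automorphism group `Out(G) = Aut(G) / Inn(G)`. -/
abbrev OuterAut (G : Type*) [Group G] : Type _ := MulAut G ⧸ InnerAut G

/-- `Aut(G)` is the (internal) semidirect product of `Inn(G) ≅ G` and a subgroup `H` which is
isomorphic to `D`: there is an isomorphism from an external semidirect product `G ⋊ D` onto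
`Aut(G)` that sends `g` to conjugation by `g` and maps `D` onto `H`. The action of `D` on `G` is
through the automorphisms that the elements of `D` are sent to. -/
def AutIsSemidirect (G : Type*) [Group G] (D : Type*) [Group D] (H : Subgroup (MulAut G)) :
    Prop :=
  ∃ (φ : D →* MulAut G) (e : G ⋊[φ] D ≃* MulAut G),
    (∀ g : G, e (SemidirectProduct.inl g) = MulAut.conj g) ∧
    (∀ d : D, e (SemidirectProduct.inr d) = φ d) ∧
    φ.range = H

/-- `Out(G) ≅ D ≅ H`, where the subgroup `H` of `Aut(G)` is mapped isomorphically onto `Out(G)`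
by the quotient map. -/
def OutIsRepresented (G : Type*) [Group G] (D : Type*) [Group D] (H : Subgroup (MulAut G)) :
    Prop :=
  Nonempty (OuterAut G ≃* D) ∧ Nonempty (H ≃* D) ∧
    Function.Bijective ((QuotientGroup.mk' (InnerAut G)).comp H.subtype)

/-!
The twin group `T_n` is a right-angled Coxeter group, and the proof runs on three facts about such
groups.

*Roots.* In the geometric representation every root is nonnegative or nonpositive, and two
generators that both shorten an element from the left commute
(`CoxeterSystem.geomRep_nonneg_or_nonpos`, `CoxeterSystem.eq_two_of_isLeftDescent`). Both come from
the sign rule `CoxeterSystem.nonneg_of_firing` by induction on the length. It follows that the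
centralizer of a set of generators is generated by the generators it contains, that the centre of
`T_n` is trivial for `n ≥ 3`, and that every involution is conjugate to a product of pairwise commuting
generators.

*Class-preserving automorphisms are inner* (`ClassPreserving.mem_innerAut`). By induction from `n`
to `n + 2`: deleting the first two generators is a retraction `T_{n+2} → T_n`, so after an inner
automorphism a class-preserving `f` fixes all generators but the first two, and fixes the first one
as well since a centralizer is generated by generators. The remaining image `f(s_2)` is the
reflection in some root. Conjugating by `s_1`, which commutes with all the generators already fixed
(and by `s_3` if there are only three generators), brings the coefficients of this root at the
neighbours of `s_2` below its coefficient at `s_2`. The root then pairs nonpositively with the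
simple roots other than `α_2`, so the images of the generators obey the same sign rule as the
generators, and this forces `f = 1` (`CoxeterSystem.map_simple_eq_of_positive_root`).

*Exponent vectors.* The abelianization of `T_n` is elementary abelian with basis the generators, and
an involution that is conjugate to a product of commuting generators is determined up to conjugacy
by its exponent vector modulo 2. Hence an automorphism is determined modulo inner automorphisms by
the exponent vectors of the images of the generators. These vectors form a basis, and the supports
of the images of commuting generators contain no two adjacent indices; for each `n` this leaves only
the vectors coming from the group `H_n` generated by `ψ` and, for `n = 4` and `n ≥ 5`, by `τ` and
`κ`. This group acts faithfully on exponent vectors, so it meets the inner automorphisms trivially.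
With the trivial centre this makes it a complement of `Inn(T_n) ≅ T_n` in `Aut(T_n)`
(`autIsSemidirect_and_outIsRepresented`).
-/

/-! ### Right-angled Coxeter systems and their geometric representation -/

/-- A Coxeter matrix is right-angled if two distinct generators either commute (entry `2`) or
satisfy no relation (entry `0`, which encodes `∞`). -/
def CoxeterMatrix.IsRightAngled {B : Type*} (M : CoxeterMatrix B) : Prop :=
  ∀ i j, i ≠ j → M i j = 2 ∨ M i j = 0

namespace CoxeterSystem

section Game

variable {B W : Type*} [Group W] {M : CoxeterMatrix B} (cs : CoxeterSystem M W)

theorem commute_simple {i j : B} (h : M i j = 2) : Commute (cs.simple i) (cs.simple j) := by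
  have h1 := cs.simple_mul_simple_pow i j
  rw [h, pow_two] at h1
  have h2 := eq_inv_of_mul_eq_one_left h1
  rw [mul_inv_rev, cs.inv_simple, cs.inv_simple] at h2
  exact h2

theorem isLeftDescent_of_simple_mul {i j : B} {w : W} (hij : M i j = 2)
    (hj : cs.IsLeftDescent w j) (hi : cs.IsLeftDescent (cs.simple j * w) i) :
    cs.IsLeftDescent w i := by
  rw [isLeftDescent_iff] at hi hj
  unfold IsLeftDescent
  have h1 : cs.simple i * w = cs.simple j * (cs.simple i * (cs.simple j * w)) := by
    rw [← mul_assoc (cs.simple i), (cs.commute_simple hij).eq, mul_assoc,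
      simple_mul_simple_cancel_left]
  have h2 := cs.length_mul_le (cs.simple j) (cs.simple i * (cs.simple j * w))
  rw [← h1, length_simple] at h2
  omega

/-- The sign rule behind everything that follows, for a right-angled Coxeter system: let numbers
`c w i` transform along left multiplication by generators in the way the pairings of a linear
functional with the images of simple roots do. If they are nonnegative at `w = 1`, then `c w i` is
nonnegative whenever `i` is not a left descent of `w`. The second part of the conclusion is what
keeps the induction on the length of `w` going: firing one of two noncommuting generators replaces
their sum by a number which is at least as large. -/
theorem nonneg_of_firing (hM : M.IsRightAngled) (c : W → B → ℤ) (k : B → B → ℤ)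
    (hself : ∀ w i, c (cs.simple i * w) i = -c w i)
    (hother : ∀ w i j, i ≠ j → c (cs.simple i * w) j = c w j + k i j * c w i)
    (hk2 : ∀ i j, i ≠ j → M i j = 2 → k i j = 0) (hk0 : ∀ i j, M i j = 0 → 2 ≤ k i j)
    (hone : ∀ i, 0 ≤ c 1 i) (w : W) :
    (∀ i, ¬ cs.IsLeftDescent w i → 0 ≤ c w i) ∧
      ∀ i j, i ≠ j → M i j = 0 → 0 ≤ c w i + c w j := by
  induction hn : cs.length w using Nat.strong_induction_on generalizing w with
  | _ n ih =>
  have key : ∀ i, ¬ cs.IsLeftDescent w i → 0 ≤ c w i := by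
    intro i hi
    by_cases hw : w = 1
    · rw [hw]; exact hone i
    obtain ⟨j, hj⟩ := cs.exists_leftDescent_of_ne_one hw
    have hij : j ≠ i := by rintro rfl; exact hi hj
    have hlt : cs.length (cs.simple j * w) < n := by rw [← hn]; exact hj
    obtain ⟨ih1, ih2⟩ := ih _ hlt (cs.simple j * w) rfl
    have hjpos : 0 ≤ c (cs.simple j * w) j :=
      ih1 j (cs.isLeftDescent_iff_not_isLeftDescent_mul.1 hj)
    have hval := hother (cs.simple j * w) j i hij
    rw [simple_mul_simple_cancel_left] at hval
    rcases hM j i hij with h | h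
    · rw [hval, hk2 j i hij h, zero_mul, add_zero]
      exact ih1 i fun hd => hi (cs.isLeftDescent_of_simple_mul (by rw [M.symmetric, h]) hj hd)
    · have := ih2 j i hij h
      have := hk0 j i h
      rw [hval]
      nlinarith
  refine ⟨key, ?_⟩
  have down : ∀ i j, i ≠ j → M i j = 0 → cs.IsLeftDescent w i → 0 ≤ c w i + c w j := by
    intro i j hij h hi
    have hlt : cs.length (cs.simple i * w) < n := by rw [← hn]; exact hi
    obtain ⟨ih1, ih2⟩ := ih _ hlt (cs.simple i * w) rfl
    have hpos := ih1 i (cs.isLeftDescent_iff_not_isLeftDescent_mul.1 hi)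
    have h1 := hself (cs.simple i * w) i
    have h2 := hother (cs.simple i * w) i j hij
    rw [simple_mul_simple_cancel_left] at h1 h2
    have := ih2 i j hij h
    have := hk0 i j h
    rw [h1, h2]
    nlinarith
  intro i j hij h
  by_cases hi : cs.IsLeftDescent w i
  · exact down i j hij h hi
  by_cases hj : cs.IsLeftDescent w j
  · rw [add_comm]; exact down j i hij.symm (by rw [M.symmetric, h]) hj
  · exact add_nonneg (key i hi) (key j hj)

end Game

end CoxeterSystem

section Form

variable {B : Type*} [DecidableEq B]

/-- The symmetric matrix of a right-angled Coxeter matrix: `1` on the diagonal, `0` for commuting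
and `-1` for noncommuting generators. -/
def CoxeterMatrix.gram (M : CoxeterMatrix B) : Matrix B B ℤ :=
  Matrix.of fun i j => if i = j then 1 else if M i j = 2 then 0 else -1

variable [Fintype B]

/-- The invariant symmetric bilinear form on the root lattice `B → ℤ`. -/
noncomputable def CoxeterMatrix.form (M : CoxeterMatrix B) : LinearMap.BilinForm ℤ (B → ℤ) :=
  Matrix.toBilin' M.gram

/-- The simple root with index `i`. -/
def simpleRoot (i : B) : B → ℤ := Pi.single i 1

variable (M : CoxeterMatrix B)

theorem form_simpleRoot (i j : B) : M.form (simpleRoot i) (simpleRoot j) =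
    if i = j then 1 else if M i j = 2 then 0 else -1 :=
  Matrix.toBilin'_single _ _ _

theorem form_comm (x y : B → ℤ) : M.form x y = M.form y x := by
  simp only [CoxeterMatrix.form, Matrix.toBilin'_apply]
  rw [Finset.sum_comm]
  refine Finset.sum_congr rfl fun i _ => Finset.sum_congr rfl fun j _ => ?_
  have : M.gram i j = M.gram j i := by
    simp only [CoxeterMatrix.gram, Matrix.of_apply, M.symmetric i j, eq_comm]
  rw [this]; ring

theorem form_simpleRoot_left (i : B) (y : B → ℤ) :
    M.form (simpleRoot i) y = ∑ j, M.gram i j * y j := by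
  simp only [CoxeterMatrix.form, Matrix.toBilin'_apply, simpleRoot, Pi.single_apply]
  rw [Finset.sum_eq_single i]
  · simp
  · intro j _ hj; simp [hj]
  · simp

/-- The reflection in the simple root with index `i`. -/
noncomputable def simpleReflection (i : B) : Module.End ℤ (B → ℤ) :=
  Module.preReflection (simpleRoot i) (2 • M.form (simpleRoot i))

theorem simpleReflection_apply (i : B) (y : B → ℤ) :
    simpleReflection M i y = y - (2 * M.form (simpleRoot i) y) • simpleRoot i := by
  simp [simpleReflection, Module.preReflection_apply]

theorem simpleReflection_isLiftable (hM : M.IsRightAngled) :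
    M.IsLiftable (simpleReflection M) := by
  intro i j
  have hcomp : ∀ y, (simpleReflection M i * simpleReflection M j) y =
      simpleReflection M i (simpleReflection M j y) := fun _ => rfl
  by_cases hij : i = j
  · subst hij
    rw [M.diagonal, pow_one]
    refine LinearMap.ext fun y => ?_
    rw [hcomp, simpleReflection_apply, simpleReflection_apply]
    simp only [map_sub, map_smul, smul_eq_mul, form_simpleRoot, if_true, Module.End.one_apply]
    module
  rcases hM i j hij with h | h
  · have hji : M.form (simpleRoot j) (simpleRoot i) = 0 := by
      simp [form_simpleRoot, Ne.symm hij, M.symmetric j i, h]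
    have hij : M.form (simpleRoot i) (simpleRoot j) = 0 := by
      rw [form_comm, hji]
    rw [h, pow_two]
    refine LinearMap.ext fun y => ?_
    rw [Module.End.mul_apply, hcomp, hcomp]
    simp only [simpleReflection_apply, map_sub, map_smul, hij, hji,
      Module.End.one_apply, form_simpleRoot M i i, form_simpleRoot M j j, if_true]
    module
  · rw [h, pow_zero]

end Form

namespace CoxeterSystem

variable {B W : Type*} [Fintype B] [DecidableEq B] [Group W] {M : CoxeterMatrix B}
  (cs : CoxeterSystem M W) (hM : M.IsRightAngled)

/-- The geometric representation of a right-angled Coxeter group on its root lattice. -/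
noncomputable def geomRep : W →* Module.End ℤ (B → ℤ) :=
  cs.lift ⟨simpleReflection M, simpleReflection_isLiftable M hM⟩

theorem geomRep_simple (i : B) (y : B → ℤ) :
    cs.geomRep hM (cs.simple i) y = y - (2 * M.form (simpleRoot i) y) • simpleRoot i := by
  rw [geomRep, lift_apply_simple, simpleReflection_apply]

theorem geomRep_mul (g h : W) (y : B → ℤ) :
    cs.geomRep hM (g * h) y = cs.geomRep hM g (cs.geomRep hM h y) := by
  rw [map_mul]; rfl

theorem geomRep_one (y : B → ℤ) : cs.geomRep hM 1 y = y := by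
  rw [map_one]; rfl

theorem geomRep_simple_self (i : B) :
    cs.geomRep hM (cs.simple i) (simpleRoot i) = -simpleRoot i := by
  rw [geomRep_simple, form_simpleRoot]
  ext j
  simp
  ring

theorem form_geomRep (w : W) (x y : B → ℤ) :
    M.form (cs.geomRep hM w x) (cs.geomRep hM w y) = M.form x y := by
  induction w using cs.simple_induction_left with
  | one => simp
  | mul_simple_left w i ih =>
    rw [geomRep_mul, geomRep_mul, geomRep_simple, geomRep_simple, ← ih]
    simp only [map_sub, map_smul, LinearMap.sub_apply, LinearMap.smul_apply, smul_eq_mul,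
      form_simpleRoot, if_true]
    rw [form_comm M _ (simpleRoot i)]
    ring

/-- A conjugate of a generator acts as the reflection in the corresponding root. -/
theorem geomRep_conj (g : W) (i : B) (y : B → ℤ) :
    cs.geomRep hM (g * cs.simple i * g⁻¹) y = y -
      (2 * M.form (cs.geomRep hM g (simpleRoot i)) y) • cs.geomRep hM g (simpleRoot i) := by
  have h : M.form (simpleRoot i) (cs.geomRep hM g⁻¹ y) =
      M.form (cs.geomRep hM g (simpleRoot i)) y := by
    rw [← cs.form_geomRep hM g, ← geomRep_mul, mul_inv_cancel, geomRep_one]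
  rw [geomRep_mul, geomRep_mul, geomRep_simple, h, map_sub, map_smul, ← geomRep_mul,
    mul_inv_cancel, geomRep_one]

theorem two_dvd_geomRep_sub (w : W) (y : B → ℤ) (k : B) : 2 ∣ cs.geomRep hM w y k - y k := by
  induction w using cs.simple_induction_left with
  | one => simp
  | mul_simple_left w i ih =>
    rw [geomRep_mul, geomRep_simple]
    simp only [Pi.sub_apply, Pi.smul_apply, smul_eq_mul, mul_assoc]
    rw [sub_right_comm]
    exact dvd_sub ih (dvd_mul_right _ _)

/-- The coefficients of the root `w⁻¹ α_i` obey the sign rule. -/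
theorem geomRep_inv_signs (w : W) (k : B) :
    (∀ i, ¬ cs.IsLeftDescent w i → 0 ≤ cs.geomRep hM w⁻¹ (simpleRoot i) k) ∧
      ∀ i j, i ≠ j → M i j = 0 →
        0 ≤ cs.geomRep hM w⁻¹ (simpleRoot i) k + cs.geomRep hM w⁻¹ (simpleRoot j) k := by
  refine cs.nonneg_of_firing hM (fun w i => cs.geomRep hM w⁻¹ (simpleRoot i) k)
    (fun i j => -2 * M.form (simpleRoot i) (simpleRoot j)) ?_ ?_ ?_ ?_ ?_ w
  · intro w i
    simp [geomRep_simple_self]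
  · intro w i j _
    simp only [mul_inv_rev, cs.inv_simple, geomRep_mul, geomRep_simple, map_sub, map_smul,
      Pi.sub_apply, Pi.smul_apply, smul_eq_mul]
    ring
  · intro i j hij h
    simp [form_simpleRoot, hij, h]
  · intro i j h
    have : i ≠ j := by rintro rfl; simp at h
    simp [form_simpleRoot, this, h]
  · intro i
    simp only [inv_one, geomRep_one, simpleRoot, Pi.single_apply]
    split_ifs <;> simp

theorem geomRep_inv_nonneg {w : W} {i : B} (h : ¬ cs.IsLeftDescent w i) :
    0 ≤ cs.geomRep hM w⁻¹ (simpleRoot i) :=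
  fun k => (cs.geomRep_inv_signs hM w k).1 i h

theorem geomRep_inv_nonpos {w : W} {i : B} (h : cs.IsLeftDescent w i) :
    cs.geomRep hM w⁻¹ (simpleRoot i) ≤ 0 := by
  have := cs.geomRep_inv_nonneg hM (cs.isLeftDescent_iff_not_isLeftDescent_mul.1 h)
  rw [mul_inv_rev, geomRep_mul, cs.inv_simple, geomRep_simple_self, map_neg] at this
  exact neg_nonneg.1 this

/-- Every root is positive or negative. -/
theorem geomRep_nonneg_or_nonpos (w : W) (i : B) :
    0 ≤ cs.geomRep hM w (simpleRoot i) ∨ cs.geomRep hM w (simpleRoot i) ≤ 0 := by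
  by_cases h : cs.IsLeftDescent w⁻¹ i
  · right; simpa using cs.geomRep_inv_nonpos hM h
  · left; simpa using cs.geomRep_inv_nonneg hM h

theorem geomRep_simpleRoot_ne_zero (w : W) (i : B) : cs.geomRep hM w (simpleRoot i) ≠ 0 := by
  intro h
  have h1 := cs.form_geomRep hM w (simpleRoot i) (simpleRoot i)
  simp [h, form_simpleRoot] at h1

include hM in
/-- Distinct left descents of an element commute. -/
theorem eq_two_of_isLeftDescent {w : W} {i j : B} (hij : i ≠ j) (hi : cs.IsLeftDescent w i)
    (hj : cs.IsLeftDescent w j) : M i j = 2 := by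
  refine (hM i j hij).resolve_right fun h => cs.geomRep_simpleRoot_ne_zero hM w⁻¹ i ?_
  ext k
  have h1 := cs.geomRep_inv_nonpos hM hi k
  have h2 := cs.geomRep_inv_nonpos hM hj k
  have h3 := (cs.geomRep_inv_signs hM w k).2 i j hij h
  simp only [Pi.zero_apply] at *
  omega

theorem geomRep_injective : Function.Injective (cs.geomRep hM) := by
  rw [injective_iff_map_eq_one]
  intro w hw
  by_contra hne
  obtain ⟨i, hi⟩ := cs.exists_leftDescent_of_ne_one hne
  have h1 := cs.geomRep_inv_nonpos hM hi i
  have h2 : cs.geomRep hM w⁻¹ = 1 := by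
    have := map_mul (cs.geomRep hM) w⁻¹ w
    rwa [inv_mul_cancel, map_one, hw, mul_one, eq_comm] at this
  rw [h2] at h1
  simp [simpleRoot] at h1

/-- The only positive root that the generator `k` makes negative is the simple root `k`. -/
theorem conj_simple_eq_simple {g : W} {i k : B} (h1 : 0 ≤ cs.geomRep hM g (simpleRoot i))
    (h2 : cs.geomRep hM (cs.simple k) (cs.geomRep hM g (simpleRoot i)) ≤ 0) :
    g * cs.simple i * g⁻¹ = cs.simple k := by
  set v := cs.geomRep hM g (simpleRoot i) with hv
  have hform : M.form v v = 1 := by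
    rw [hv, form_geomRep, form_simpleRoot, if_pos rfl]
  have hvk : v = v k • simpleRoot k := by
    ext j
    by_cases hj : j = k
    · subst hj; simp [simpleRoot]
    · have a := h1 j
      have b := h2 j
      rw [geomRep_simple] at b
      simp [simpleRoot, hj] at a b ⊢
      omega
  have hsq : v k * v k = 1 := by
    have h := hform
    rw [hvk] at h
    simpa only [map_smul, LinearMap.smul_apply, form_simpleRoot, if_true, smul_eq_mul,
      mul_one] using h
  have hone : v k = 1 := by
    have := h1 k
    simp only [Pi.zero_apply] at this
    nlinarith
  rw [hone, one_smul] at hvk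
  apply cs.geomRep_injective hM
  refine LinearMap.ext fun y => ?_
  rw [geomRep_conj, geomRep_simple, ← hv, hvk]

/-- The exchange property, in the form in which it is used here. -/
theorem simple_mul_eq_mul_simple {h : W} {i k : B} (h1 : ¬ cs.IsLeftDescent h i)
    (h2 : cs.IsLeftDescent (h * cs.simple k) i) (hM : M.IsRightAngled) :
    cs.simple i * h = h * cs.simple k := by
  have a := cs.geomRep_inv_nonneg hM h1
  have b := cs.geomRep_inv_nonpos hM h2
  rw [mul_inv_rev, cs.inv_simple, geomRep_mul] at b
  have := cs.conj_simple_eq_simple hM a b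
  rw [inv_inv] at this
  rw [← this]
  group

end CoxeterSystem

/-! ### Centralizers, involutions and rigidity in right-angled Coxeter groups -/

namespace CoxeterSystem

variable {B W : Type*} [Fintype B] [DecidableEq B] [Group W] {M : CoxeterMatrix B}
  (cs : CoxeterSystem M W) (hM : M.IsRightAngled)

include hM in
/-- If `z` commutes with a generator, then so does every left descent of `z`. -/
theorem eq_or_eq_two_of_commute {z : W} {i u : B} (hz : Commute z (cs.simple i))
    (hu : cs.IsLeftDescent z u) : u = i ∨ M u i = 2 := by
  by_cases hui : u = i
  · exact Or.inl hui
  refine Or.inr ?_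
  by_cases hi : cs.IsLeftDescent z i
  · exact cs.eq_two_of_isLeftDescent hM hui hu hi
  refine cs.eq_two_of_isLeftDescent hM (w := cs.simple i * z) hui ?_ ?_
  · rw [not_isLeftDescent_iff] at hi
    unfold IsLeftDescent at hu ⊢
    rw [hi, ← hz.eq, ← mul_assoc]
    have := cs.length_mul_le (cs.simple u * z) (cs.simple i)
    rw [length_simple] at this
    omega
  · by_contra h
    exact hi (cs.isLeftDescent_iff_not_isLeftDescent_mul.2 h)

include hM in
/-- The centralizer of a set of generators is generated by the generators that it contains. -/
theorem mem_closure_of_commute (X : Set B) {z : W} (hz : ∀ i ∈ X, Commute z (cs.simple i)) :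
    z ∈ Subgroup.closure (cs.simple '' {u | ∀ i ∈ X, u = i ∨ M u i = 2}) := by
  induction hn : cs.length z using Nat.strong_induction_on generalizing z with
  | _ n ih =>
  by_cases h1 : z = 1
  · rw [h1]; exact one_mem _
  obtain ⟨u, hu⟩ := cs.exists_leftDescent_of_ne_one h1
  have huX : ∀ i ∈ X, u = i ∨ M u i = 2 := fun i hi =>
    cs.eq_or_eq_two_of_commute hM (hz i hi) hu
  have hmem : cs.simple u ∈ Subgroup.closure (cs.simple '' {u | ∀ i ∈ X, u = i ∨ M u i = 2}) :=
    Subgroup.subset_closure ⟨u, huX, rfl⟩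
  have := ih _ (hn ▸ hu) (z := cs.simple u * z) (fun i hi => ?_) rfl
  · simpa using mul_mem hmem this
  · refine Commute.mul_left ?_ (hz i hi)
    rcases huX i hi with rfl | h
    · exact Commute.refl _
    · exact cs.commute_simple h

include cs hM in
/-- The centre of a right-angled Coxeter group is trivial as soon as no generator commutes with all
the others. -/
theorem eq_one_of_forall_commute (hirr : ∀ i, ∃ j, M i j = 0) {z : W} (hz : ∀ w, Commute z w) :
    z = 1 := by
  by_contra h1
  obtain ⟨u, hu⟩ := cs.exists_leftDescent_of_ne_one h1
  obtain ⟨j, hj⟩ := hirr u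
  rcases cs.eq_or_eq_two_of_commute hM (hz (cs.simple j)) hu with rfl | h
  · simp at hj
  · omega

include hM in
/-- An element that commutes with all of its left descents is the product of some of them. -/
theorem exists_list_of_commute_descents {w : W}
    (hw : ∀ i, cs.IsLeftDescent w i → Commute w (cs.simple i)) :
    ∃ L : List B, L.Nodup ∧ (∀ i ∈ L, cs.IsLeftDescent w i) ∧ w = (L.map cs.simple).prod := by
  induction hn : cs.length w using Nat.strong_induction_on generalizing w with
  | _ n ih =>
  by_cases h1 : w = 1
  · exact ⟨[], by simp, by simp, by simp [h1]⟩
  obtain ⟨i, hi⟩ := cs.exists_leftDescent_of_ne_one h1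
  have hdesc : ∀ j, cs.IsLeftDescent (cs.simple i * w) j → j ≠ i ∧ cs.IsLeftDescent w j := by
    intro j hj
    refine ⟨fun h => ?_, ?_⟩
    · subst h; exact cs.isLeftDescent_iff_not_isLeftDescent_mul.1 hi hj
    · rw [isLeftDescent_iff] at hi
      unfold IsLeftDescent at hj ⊢
      have h2 := cs.length_mul_le (cs.simple j * (cs.simple i * w)) (cs.simple i)
      rw [length_simple, ← (hw i (cs.isLeftDescent_iff.2 hi)).eq, mul_assoc, mul_assoc,
        simple_mul_simple_self, mul_one, (hw i (cs.isLeftDescent_iff.2 hi)).eq] at h2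
      omega
  obtain ⟨L, hL1, hL2, hL3⟩ := ih _ (hn ▸ hi) (w := cs.simple i * w) (fun j hj => by
    obtain ⟨hne, hjw⟩ := hdesc j hj
    exact (cs.commute_simple (cs.eq_two_of_isLeftDescent hM hne.symm hi hjw)).mul_left
      (hw j hjw)) rfl
  refine ⟨i :: L, ?_, ?_, ?_⟩
  · exact List.nodup_cons.2 ⟨fun h => (hdesc i (hL2 i h)).1 rfl, hL1⟩
  · intro j hj
    rcases List.mem_cons.1 hj with rfl | hj
    · exact hi
    · exact (hdesc j (hL2 j hj)).2
  · rw [List.map_cons, List.prod_cons, ← hL3, simple_mul_simple_cancel_left]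

include hM in
/-- Every involution is conjugate to a product of pairwise commuting generators. -/
theorem exists_conj_list_of_sq_eq_one {w : W} (hw : w * w = 1) :
    ∃ (g : W) (L : List B), L.Nodup ∧ (∀ i ∈ L, ∀ j ∈ L, i ≠ j → M i j = 2) ∧
      w = g * (L.map cs.simple).prod * g⁻¹ := by
  induction hn : cs.length w using Nat.strong_induction_on generalizing w with
  | _ n ih =>
  by_cases h : ∀ i, cs.IsLeftDescent w i → Commute w (cs.simple i)
  · obtain ⟨L, h1, h2, h3⟩ := cs.exists_list_of_commute_descents hM h
    exact ⟨1, L, h1, fun i hi j hj hij => cs.eq_two_of_isLeftDescent hM hij (h2 i hi) (h2 j hj),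
      by simpa using h3⟩
  push Not at h
  obtain ⟨i, hi, hc⟩ := h
  have hright : cs.IsRightDescent w i := by
    rw [← cs.isLeftDescent_inv_iff, ← eq_inv_of_mul_eq_one_left hw]; exact hi
  have hlt : cs.length (cs.simple i * w * cs.simple i) < n := by
    by_contra hge
    have h1 : ¬ cs.IsLeftDescent (cs.simple i * w) i :=
      cs.isLeftDescent_iff_not_isLeftDescent_mul.1 hi
    have h2 : cs.IsLeftDescent (cs.simple i * w * cs.simple i) i := by
      unfold IsLeftDescent IsRightDescent at *
      rw [← mul_assoc, ← mul_assoc, simple_mul_simple_self, one_mul]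
      omega
    have h3 := cs.simple_mul_eq_mul_simple h1 h2 hM
    rw [simple_mul_simple_cancel_left] at h3
    apply hc
    unfold Commute SemiconjBy
    nth_rw 1 [h3]
    rw [mul_assoc, mul_assoc, simple_mul_simple_self, mul_one]
  obtain ⟨g, L, h1, h2, h3⟩ := ih _ hlt (w := cs.simple i * w * cs.simple i) (by
    have : cs.simple i * w * cs.simple i * (cs.simple i * w * cs.simple i) =
        cs.simple i * (w * (cs.simple i * cs.simple i) * w) * cs.simple i := by group
    rw [this, simple_mul_simple_self, mul_one, hw, mul_one, simple_mul_simple_self]) rfl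
  refine ⟨cs.simple i * g, L, h1, h2, ?_⟩
  have : cs.simple i * g * (L.map cs.simple).prod * (cs.simple i * g)⁻¹ =
      cs.simple i * (g * (L.map cs.simple).prod * g⁻¹) * cs.simple i := by
    rw [mul_inv_rev, cs.inv_simple]; group
  rw [this, ← h3, mul_assoc (cs.simple i) w, simple_mul_simple_cancel_left,
    simple_mul_simple_cancel_right]

/-- Rigidity: suppose that an automorphism fixes all generators but one, and sends that one to the
reflection in a positive root `β` which pairs with the other simple roots as in a (generalized)
right-angled root basis. Then it fixes the last generator, too. Indeed the sign rule applies to the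
simple roots with the exceptional one replaced by `β`: every nontrivial element, in particular the
exceptional generator, makes one of these roots negative, and this can only be `β`. -/
theorem map_simple_eq_of_positive_root (F : MulAut W) (i₀ : B)
    (hF : ∀ i, i ≠ i₀ → F (cs.simple i) = cs.simple i) (g : W)
    (hg : F (cs.simple i₀) = g * cs.simple i₀ * g⁻¹)
    (hpos : 0 ≤ cs.geomRep hM g (simpleRoot i₀))
    (h2 : ∀ i, i ≠ i₀ → M i i₀ = 2 → M.form (simpleRoot i) (cs.geomRep hM g (simpleRoot i₀)) = 0)
    (h0 : ∀ i, M i i₀ = 0 → M.form (simpleRoot i) (cs.geomRep hM g (simpleRoot i₀)) ≤ -1) :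
    F (cs.simple i₀) = cs.simple i₀ := by
  classical
  set β : B → B → ℤ := fun i => if i = i₀ then cs.geomRep hM g (simpleRoot i₀) else simpleRoot i
    with hβ
  have hβ0 : β i₀ = cs.geomRep hM g (simpleRoot i₀) := by simp [hβ]
  have hβi : ∀ i, i ≠ i₀ → β i = simpleRoot i := fun i hi => by simp [hβ, hi]
  have hact : ∀ i y, cs.geomRep hM (F (cs.simple i)) y = y - (2 * M.form (β i) y) • β i := by
    intro i y
    by_cases hi : i = i₀
    · rw [hi, hβ0, hg, geomRep_conj]
    · rw [hF i hi, hβi i hi, geomRep_simple]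
  have hself : ∀ i, M.form (β i) (β i) = 1 := by
    intro i
    by_cases hi : i = i₀
    · rw [hi, hβ0, form_geomRep, form_simpleRoot, if_pos rfl]
    · rw [hβi i hi, form_simpleRoot, if_pos rfl]
  have hform2 : ∀ i j, i ≠ j → M i j = 2 → M.form (β i) (β j) = 0 := by
    intro i j hij h
    by_cases hi : i = i₀
    · subst hi
      rw [hβ0, hβi j hij.symm, form_comm]
      exact h2 j hij.symm (by rw [M.symmetric, h])
    by_cases hj : j = i₀
    · subst hj
      rw [hβ0, hβi i hi]
      exact h2 i hi h
    · rw [hβi i hi, hβi j hj, form_simpleRoot]; simp [hij, h]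
  have hform0 : ∀ i j, M i j = 0 → M.form (β i) (β j) ≤ -1 := by
    intro i j h
    have hij : i ≠ j := by rintro rfl; simp at h
    by_cases hi : i = i₀
    · subst hi
      rw [hβ0, hβi j hij.symm, form_comm]
      exact h0 j (by rw [M.symmetric, h])
    by_cases hj : j = i₀
    · subst hj
      rw [hβ0, hβi i hi]
      exact h0 i h
    · rw [hβi i hi, hβi j hj, form_simpleRoot]; simp [hij, h]
  have hnonneg : ∀ i, 0 ≤ β i := by
    intro i
    by_cases hi : i = i₀
    · rw [hi, hβ0]; exact hpos
    · rw [hβi i hi]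
      intro k
      simp only [simpleRoot, Pi.single_apply]
      split_ifs <;> simp
  have hreflect : ∀ i, cs.geomRep hM (F (cs.simple i)) (β i) = - β i := by
    intro i
    rw [hact, hself]; module
  have hinv : ∀ w i, cs.geomRep hM (F (cs.simple i * w))⁻¹ =
      cs.geomRep hM (F w)⁻¹ * cs.geomRep hM (F (cs.simple i)) := by
    intro w i
    rw [map_mul, mul_inv_rev, ← map_inv F (cs.simple i), cs.inv_simple, map_mul]
  have hsigns : ∀ w i, cs.IsLeftDescent w i → cs.geomRep hM (F w)⁻¹ (β i) ≤ 0 := by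
    intro w i hi k
    have h := (cs.nonneg_of_firing hM (fun w i => cs.geomRep hM (F w)⁻¹ (β i) k)
      (fun i j => -2 * M.form (β i) (β j)) ?_ ?_ ?_ ?_ ?_ (cs.simple i * w)).1 i
      (cs.isLeftDescent_iff_not_isLeftDescent_mul.1 hi)
    · simp only [hinv, Module.End.mul_apply, hreflect, map_neg, Pi.neg_apply] at h
      simpa using h
    · intro w i
      simp only [hinv, Module.End.mul_apply, hreflect, map_neg, Pi.neg_apply]
    · intro w i j _
      simp only [hinv, Module.End.mul_apply, hact, map_sub, map_smul, Pi.sub_apply, Pi.smul_apply,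
        smul_eq_mul]
      ring
    · intro i j hij h
      simp only [hform2 i j hij h, mul_zero]
    · intro i j h
      have := hform0 i j h
      linarith only [this]
    · intro i
      simpa using hnonneg i k
  obtain ⟨w, hw⟩ := F.surjective (cs.simple i₀)
  have hw1 : w ≠ 1 := by
    rintro rfl
    have := cs.length_simple i₀
    rw [← hw, map_one, length_one] at this
    exact zero_ne_one this
  obtain ⟨i, hi⟩ := cs.exists_leftDescent_of_ne_one hw1
  have hneg := hsigns w i hi
  rw [hw, cs.inv_simple] at hneg
  by_cases hii : i = i₀
  · rw [hii, hβ0] at hneg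
    rw [hg]
    exact cs.conj_simple_eq_simple hM hpos hneg
  · have := hneg i
    rw [hβi i hii, geomRep_simple] at this
    simp [simpleRoot, hii] at this

end CoxeterSystem

/-! ### The twin group as a right-angled Coxeter group -/

instance twinIndexFintype (n : ℕ) : Fintype (TwinIndex n) :=
  Fintype.subtype (Finset.Ico 1 n) fun i => by rw [Finset.mem_Ico]

/-- The Coxeter matrix of the twin group `T_n`. -/
def twinMatrix (n : ℕ) : CoxeterMatrix (TwinIndex n) where
  M := Matrix.of fun i j =>
    if i = j then 1 else if 2 ≤ |((i : ℕ) : ℤ) - ((j : ℕ) : ℤ)| then 2 else 0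
  isSymm := by
    ext i j
    simp only [Matrix.transpose_apply, Matrix.of_apply, eq_comm, abs_sub_comm]
  diagonal i := by simp
  off_diagonal i j h := by
    simp only [Matrix.of_apply, h, if_false]
    split_ifs <;> decide

theorem twinMatrix_apply {n : ℕ} (i j : TwinIndex n) : twinMatrix n i j =
    if i = j then 1 else if 2 ≤ |((i : ℕ) : ℤ) - ((j : ℕ) : ℤ)| then 2 else 0 := rfl

theorem twinMatrix_eq_two {n : ℕ} {i j : TwinIndex n} :
    twinMatrix n i j = 2 ↔ (i : ℕ) + 2 ≤ j ∨ (j : ℕ) + 2 ≤ i := by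
  rw [twinMatrix_apply]
  split_ifs with h1 h2
  · subst h1; simp
  · simp only [true_iff]; rw [le_abs] at h2; omega
  · rw [le_abs] at h2; simp only [false_iff]; omega

theorem twinMatrix_eq_zero {n : ℕ} {i j : TwinIndex n} :
    twinMatrix n i j = 0 ↔ (i : ℕ) + 1 = j ∨ (j : ℕ) + 1 = i := by
  rw [twinMatrix_apply]
  split_ifs with h1 h2
  · subst h1; simp
  · rw [le_abs] at h2; simp only [false_iff]; omega
  · rw [le_abs] at h2
    have : (i : ℕ) ≠ j := fun h => h1 (Subtype.ext h)
    simp only [true_iff]; omega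

theorem twinMatrix_isRightAngled (n : ℕ) : (twinMatrix n).IsRightAngled := by
  intro i j h
  rw [twinMatrix_eq_two, twinMatrix_eq_zero]
  have : (i : ℕ) ≠ j := fun h' => h (Subtype.ext h')
  omega

theorem twinGen_of_mem {n : ℕ} (i : TwinIndex n) : twinGen n i = PresentedGroup.of i := by
  rw [twinGen, dif_pos i.2]

theorem twinGen_eq_one {n i : ℕ} (h : ¬(1 ≤ i ∧ i < n)) : twinGen n i = 1 := dif_neg h

theorem twinGen_mul_self (n i : ℕ) : twinGen n i * twinGen n i = 1 := by
  by_cases h : 1 ≤ i ∧ i < n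
  · rw [twinGen, dif_pos h, ← pow_two]
    exact PresentedGroup.one_of_mem (Or.inl ⟨⟨i, h⟩, rfl⟩)
  · simp [twinGen_eq_one h]

theorem twinGen_inv (n i : ℕ) : (twinGen n i)⁻¹ = twinGen n i :=
  inv_eq_of_mul_eq_one_left (twinGen_mul_self n i)

theorem twinGen_comm {n i j : ℕ} (h : i + 1 ≠ j ∧ j + 1 ≠ i) :
    Commute (twinGen n i) (twinGen n j) := by
  by_cases hij : i = j
  · rw [hij]
  by_cases hi : 1 ≤ i ∧ i < n
  · by_cases hj : 1 ≤ j ∧ j < n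
    · rw [twinGen, dif_pos hi, twinGen, dif_pos hj]
      refine PresentedGroup.mk_eq_mk_of_mul_inv_mem (Or.inr ⟨⟨i, hi⟩, ⟨j, hj⟩, ?_, rfl⟩)
      rw [le_abs]
      simp only
      omega
    · rw [twinGen_eq_one hj]; exact Commute.one_right _
  · rw [twinGen_eq_one hi]; exact Commute.one_left _

/-- The homomorphism out of the twin group given by values on the generators. -/
def twinLift {G : Type*} [Group G] (n : ℕ) (f : ℕ → G) (hsq : ∀ i, 1 ≤ i → i < n → f i * f i = 1)
    (hcomm : ∀ i j, 1 ≤ i → i + 2 ≤ j → j < n → f i * f j = f j * f i) : TwinGroup n →* G :=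
  PresentedGroup.toGroup (f := fun i : TwinIndex n => f i) (by
    rintro r (⟨i, rfl⟩ | ⟨i, j, hij, rfl⟩)
    · simpa [pow_two] using hsq i i.2.1 i.2.2
    · simp only [map_mul, map_inv, FreeGroup.lift_apply_of]
      rw [mul_inv_eq_one]
      rw [le_abs] at hij
      rcases hij with h | h
      · exact (hcomm j i j.2.1 (by omega) i.2.2).symm
      · exact hcomm i j i.2.1 (by omega) j.2.2)

theorem twinLift_twinGen {G : Type*} [Group G] {n : ℕ} {f : ℕ → G}
    (hsq : ∀ i, 1 ≤ i → i < n → f i * f i = 1)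
    (hcomm : ∀ i j, 1 ≤ i → i + 2 ≤ j → j < n → f i * f j = f j * f i) {i : ℕ} (h1 : 1 ≤ i)
    (h2 : i < n) : twinLift n f hsq hcomm (twinGen n i) = f i := by
  rw [twinGen, dif_pos ⟨h1, h2⟩]
  exact PresentedGroup.toGroup.of _

theorem twin_hom_ext {G : Type*} [Group G] {n : ℕ} {f g : TwinGroup n →* G}
    (h : ∀ i, 1 ≤ i → i < n → f (twinGen n i) = g (twinGen n i)) : f = g := by
  refine PresentedGroup.ext fun i => ?_
  rw [← twinGen_of_mem]
  exact h i i.2.1 i.2.2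

theorem twin_aut_ext {n : ℕ} {f g : MulAut (TwinGroup n)}
    (h : ∀ i, 1 ≤ i → i < n → f (twinGen n i) = g (twinGen n i)) : f = g := by
  have := twin_hom_ext (f := f.toMonoidHom) (g := g.toMonoidHom) h
  exact MulEquiv.ext fun x => DFunLike.congr_fun this x

theorem twinGen_isLiftable (n : ℕ) :
    (twinMatrix n).IsLiftable (fun i : TwinIndex n => twinGen n i) := by
  intro i j
  by_cases hij : i = j
  · rw [hij, twinGen_mul_self, one_pow]
  rcases twinMatrix_isRightAngled n i j hij with h | h
  · rw [h]
    rw [twinMatrix_eq_two] at h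
    rw [(twinGen_comm (by omega)).mul_pow, pow_two, pow_two, twinGen_mul_self,
      twinGen_mul_self, one_mul]
  · rw [h, pow_zero]

/-- The twin group as a Coxeter system. -/
noncomputable def twinSystem (n : ℕ) : CoxeterSystem (twinMatrix n) (TwinGroup n) where
  mulEquiv := MonoidHom.toMulEquiv
    (twinLift n (fun i =>
      if h : 1 ≤ i ∧ i < n then (twinMatrix n).toCoxeterSystem.simple ⟨i, h⟩ else 1)
      (fun i h1 h2 => by
        rw [dif_pos ⟨h1, h2⟩]
        exact (twinMatrix n).toCoxeterSystem.simple_mul_simple_self _)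
      (fun i j h1 h2 h3 => by
        rw [dif_pos ⟨h1, by omega⟩, dif_pos ⟨by omega, h3⟩]
        exact (twinMatrix n).toCoxeterSystem.commute_simple (twinMatrix_eq_two.2 (Or.inl h2))))
    ((twinMatrix n).toCoxeterSystem.lift ⟨_, twinGen_isLiftable n⟩)
    (by
      apply twin_hom_ext
      intro i h1 h2
      rw [MonoidHom.comp_apply, twinLift_twinGen _ _ h1 h2, dif_pos ⟨h1, h2⟩]
      exact (twinMatrix n).toCoxeterSystem.lift_apply_simple _ _)
    (by
      apply (twinMatrix n).toCoxeterSystem.ext_simple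
      intro i
      have h := (twinMatrix n).toCoxeterSystem.lift_apply_simple (twinGen_isLiftable n) i
      rw [MonoidHom.comp_apply, h, twinLift_twinGen _ _ i.2.1 i.2.2, dif_pos i.2]
      rfl)

theorem twinSystem_simple {n : ℕ} (i : TwinIndex n) : (twinSystem n).simple i = twinGen n i :=
  (twinMatrix n).toCoxeterSystem.lift_apply_simple _ i

theorem twin_eq_one_of_central {n : ℕ} (hn : 3 ≤ n) {z : TwinGroup n} (hz : ∀ w, Commute z w) :
    z = 1 := by
  refine (twinSystem n).eq_one_of_forall_commute (twinMatrix_isRightAngled n) (fun i => ?_) hz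
  have := i.2
  by_cases h : (i : ℕ) = 1
  · exact ⟨⟨2, by omega⟩, twinMatrix_eq_zero.2 (by simp; omega)⟩
  · exact ⟨⟨i - 1, by omega⟩, twinMatrix_eq_zero.2 (by simp; omega)⟩

/-! ### The action on the abelianization -/

/-- The abelianization of the twin group, written as the homomorphism to `ℕ → ℤ/2` that counts the
occurrences of each generator modulo 2. -/
def twinAb (n : ℕ) : TwinGroup n →* Multiplicative (ℕ → ZMod 2) :=
  twinLift n (fun i => Multiplicative.ofAdd (Pi.single i 1))
    (fun i _ _ => by
      rw [← ofAdd_add, CharTwo.add_self_eq_zero]; rfl)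
    (fun i j _ _ _ => mul_comm _ _)

/-- The exponent vector modulo 2 of an element of the twin group. -/
def twinVec {n : ℕ} (x : TwinGroup n) : ℕ → ZMod 2 := Multiplicative.toAdd (twinAb n x)

theorem twinVec_mul {n : ℕ} (x y : TwinGroup n) : twinVec (x * y) = twinVec x + twinVec y := by
  simp [twinVec]

theorem twinVec_one {n : ℕ} : twinVec (1 : TwinGroup n) = 0 := by
  simp [twinVec]

theorem twinVec_twinGen {n i : ℕ} (h1 : 1 ≤ i) (h2 : i < n) :
    twinVec (twinGen n i) = Pi.single i 1 := by
  rw [twinVec, twinAb, twinLift_twinGen _ _ h1 h2]; rfl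

theorem twinVec_conj {n : ℕ} (g x : TwinGroup n) : twinVec (g * x * g⁻¹) = twinVec x := by
  have h : twinVec g + twinVec g⁻¹ = 0 := by rw [← twinVec_mul, mul_inv_cancel, twinVec_one]
  rw [twinVec_mul, twinVec_mul, add_right_comm, h, zero_add]

theorem twinVec_eq_of_isConj {n : ℕ} {x y : TwinGroup n} (h : IsConj x y) :
    twinVec x = twinVec y := by
  obtain ⟨g, rfl⟩ := isConj_iff.1 h
  exact (twinVec_conj g x).symm

/-- An automorphism acts linearly on exponent vectors. -/
theorem twinVec_map {n : ℕ} (f : MulAut (TwinGroup n)) (x : TwinGroup n) :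
    twinVec (f x) = ∑ i ∈ Finset.range n, twinVec x i • twinVec (f (twinGen n i)) := by
  let lin : TwinGroup n →* Multiplicative (ℕ → ZMod 2) :=
    { toFun := fun x => Multiplicative.ofAdd
        (∑ i ∈ Finset.range n, twinVec x i • twinVec (f (twinGen n i)))
      map_one' := by simp [twinVec_one]
      map_mul' := fun x y => by
        simp [twinVec_mul, add_smul, Finset.sum_add_distrib] }
  have h : (twinAb n).comp f.toMonoidHom = lin := by
    apply twin_hom_ext
    intro i h1 h2
    change Multiplicative.ofAdd (twinVec (f (twinGen n i))) =
      Multiplicative.ofAdd (∑ j ∈ Finset.range n, twinVec (twinGen n i) j •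
        twinVec (f (twinGen n j)))
    rw [twinVec_twinGen h1 h2, Finset.sum_eq_single i]
    · simp
    · intro j _ hj; simp [hj]
    · simp [h2]
  exact DFunLike.congr_fun h x

theorem twinVec_list_prod {n : ℕ} (L : List (TwinIndex n)) (hL : L.Nodup) (p : TwinIndex n) :
    twinVec (L.map (twinSystem n).simple).prod p = if p ∈ L then 1 else 0 := by
  induction L with
  | nil => simp [twinVec_one]
  | cons a L ih =>
    rw [List.nodup_cons] at hL
    rw [List.map_cons, List.prod_cons, twinVec_mul, twinSystem_simple,
      twinVec_twinGen a.2.1 a.2.2, Pi.add_apply, ih hL.2]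
    by_cases h : p = a
    · subst h; simp [hL.1]
    · have : (p : ℕ) ≠ a := fun h' => h (Subtype.ext h')
      simp [h, this]

/-- The exponent vector of an involution is supported on pairwise commuting generators. -/
theorem twinVec_eq_zero_of_involution {n : ℕ} {w : TwinGroup n} (hw : w * w = 1) {p q : ℕ}
    (hp : 1 ≤ p ∧ p < n) (hq : 1 ≤ q ∧ q < n) (hpq : p + 1 = q ∨ q + 1 = p) :
    twinVec w p = 0 ∨ twinVec w q = 0 := by
  obtain ⟨g, L, h1, h2, h3⟩ :=
    (twinSystem n).exists_conj_list_of_sq_eq_one (twinMatrix_isRightAngled n) hw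
  rw [h3, twinVec_conj]
  have ep := twinVec_list_prod L h1 ⟨p, hp⟩
  have eq := twinVec_list_prod L h1 ⟨q, hq⟩
  simp only at ep eq
  rw [ep, eq]
  by_contra hcon
  simp only [ite_eq_right_iff, one_ne_zero, imp_false, not_or, not_not] at hcon
  have h4 := h2 _ hcon.1 _ hcon.2 (by intro h; simp at h; omega)
  rw [twinMatrix_eq_two] at h4
  simp only at h4
  omega

/-- An involution with the exponent vector of a generator is conjugate to that generator. -/
theorem isConj_of_involution {n : ℕ} {w : TwinGroup n} (hw : w * w = 1) {i : ℕ} (hi1 : 1 ≤ i)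
    (hi2 : i < n) (hv : twinVec w = twinVec (twinGen n i)) : IsConj (twinGen n i) w := by
  obtain ⟨g, L, h1, h2, h3⟩ :=
    (twinSystem n).exists_conj_list_of_sq_eq_one (twinMatrix_isRightAngled n) hw
  rw [h3, twinVec_conj, twinVec_twinGen hi1 hi2] at hv
  have hmem : ∀ p : TwinIndex n, p ∈ L ↔ p = ⟨i, hi1, hi2⟩ := by
    intro p
    have := twinVec_list_prod L h1 p
    rw [hv, Pi.single_apply] at this
    rw [Subtype.ext_iff]
    by_cases hp : p ∈ L <;> by_cases hp' : (p : ℕ) = i <;> simp_all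
  have hL : L = [⟨i, hi1, hi2⟩] := by
    rw [← List.perm_singleton, List.perm_ext_iff_of_nodup h1 (List.nodup_singleton _)]
    intro p
    rw [hmem p, List.mem_singleton]
  rw [isConj_iff]
  refine ⟨g, ?_⟩
  rw [h3, hL, List.map_singleton, List.prod_singleton, twinSystem_simple]

/-! ### Class-preserving automorphisms are inner -/

/-- An automorphism of the twin group that sends every generator to a conjugate of itself. -/
def ClassPreserving {n : ℕ} (f : MulAut (TwinGroup n)) : Prop :=
  ∀ i, 1 ≤ i → i < n → IsConj (twinGen n i) (f (twinGen n i))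

theorem ClassPreserving.conj_mul {n : ℕ} {f : MulAut (TwinGroup n)} (hf : ClassPreserving f)
    (h : TwinGroup n) : ClassPreserving (MulAut.conj h * f) := fun i h1 h2 =>
  (hf i h1 h2).trans (isConj_iff.2 ⟨h, rfl⟩)

theorem mem_innerAut_of_conj_mul {G : Type*} [Group G] {f : MulAut G} {h : G}
    (hf : MulAut.conj h * f ∈ InnerAut G) : f ∈ InnerAut G :=
  (Subgroup.mul_mem_cancel_left (InnerAut G) (MonoidHom.mem_range.2 ⟨h, rfl⟩)).1 hf

theorem isConj_inv_apply {G : Type*} [Group G] {f : MulAut G} {x : G} (h : IsConj x (f x)) :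
    IsConj x (f⁻¹ x) := by
  have := f⁻¹.toMonoidHom.map_isConj h
  simp only [MulEquiv.toMonoidHom_eq_coe, MonoidHom.coe_coe, MulAut.inv_apply_self] at this
  exact this.symm

/-- The embedding `T_n → T_{n+2}` with `s_i ↦ s_{i+2}`. -/
def twinShift (n : ℕ) : TwinGroup n →* TwinGroup (n + 2) :=
  twinLift n (fun i => twinGen (n + 2) (i + 2)) (fun _ _ _ => twinGen_mul_self _ _)
    (fun _ _ _ _ _ => twinGen_comm (by omega))

/-- The retraction `T_{n+2} → T_n` with `s_i ↦ s_{i-2}` for `i ≥ 3`, which kills `s_1` and `s_2`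
(for these the truncated subtraction gives the index `0`, whose generator is `1` by convention). -/
def twinDrop (n : ℕ) : TwinGroup (n + 2) →* TwinGroup n :=
  twinLift (n + 2) (fun i => twinGen n (i - 2)) (fun _ _ _ => twinGen_mul_self _ _)
    (fun i j _ _ _ => by
      by_cases h : i - 2 = 0
      · rw [h, twinGen_eq_one (by omega : ¬(1 ≤ 0 ∧ 0 < n)), one_mul, mul_one]
      · exact twinGen_comm (by omega))

theorem twinShift_twinGen {n i : ℕ} (h1 : 1 ≤ i) (h2 : i < n) :
    twinShift n (twinGen n i) = twinGen (n + 2) (i + 2) := twinLift_twinGen _ _ h1 h2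

theorem twinDrop_twinGen {n i : ℕ} (h1 : 1 ≤ i) (h2 : i < n + 2) :
    twinDrop n (twinGen (n + 2) i) = twinGen n (i - 2) := twinLift_twinGen _ _ h1 h2

theorem twinDrop_twinGen_le {n i : ℕ} (h1 : 1 ≤ i) (h2 : i ≤ 2) :
    twinDrop n (twinGen (n + 2) i) = 1 := by
  rw [twinDrop]
  by_cases h : i < n + 2
  · rw [twinLift_twinGen _ _ h1 h, twinGen_eq_one (by omega)]
  · rw [twinGen_eq_one (by omega), map_one]

theorem twinDrop_twinShift {n : ℕ} (x : TwinGroup n) : twinDrop n (twinShift n x) = x := by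
  have : (twinDrop n).comp (twinShift n) = MonoidHom.id _ := by
    apply twin_hom_ext
    intro i h1 h2
    rw [MonoidHom.comp_apply, twinShift_twinGen h1 h2, twinDrop_twinGen (by omega) (by omega)]
    rfl
  exact DFunLike.congr_fun this x

theorem twinShift_commute {n : ℕ} (x : TwinGroup n) :
    Commute (twinGen (n + 2) 1) (twinShift n x) := by
  have : (MulAut.conj (twinGen (n + 2) 1)).toMonoidHom.comp (twinShift n) = twinShift n := by
    apply twin_hom_ext
    intro i h1 h2
    simp only [MonoidHom.comp_apply, twinShift_twinGen h1 h2]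
    change twinGen (n + 2) 1 * twinGen (n + 2) (i + 2) * (twinGen (n + 2) 1)⁻¹ = _
    exact mul_inv_eq_of_eq_mul (twinGen_comm (by omega)).eq
  have h := DFunLike.congr_fun this x
  change twinGen (n + 2) 1 * twinShift n x * (twinGen (n + 2) 1)⁻¹ = _ at h
  exact mul_inv_eq_iff_eq_mul.1 h

/-- The centralizer of `s_1` is the direct product of `⟨s_1⟩` and `⟨s_3, …, s_{n+1}⟩`. -/
theorem eq_shift_drop_of_commute {n : ℕ} {z : TwinGroup (n + 2)}
    (hz : Commute z (twinGen (n + 2) 1)) :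
    z = twinShift n (twinDrop n z) ∨ z = twinGen (n + 2) 1 * twinShift n (twinDrop n z) := by
  let i1 : TwinIndex (n + 2) := ⟨1, by omega⟩
  have hmem := (twinSystem (n + 2)).mem_closure_of_commute (twinMatrix_isRightAngled _) {i1}
    (z := z) (by
      rintro i rfl
      rw [twinSystem_simple]
      exact hz)
  have hs := twinGen_mul_self (n + 2) 1
  clear hz
  induction hmem using Subgroup.closure_induction with
  | mem x hx =>
    obtain ⟨u, hu, rfl⟩ := hx
    have hu1 := u.2
    rw [twinSystem_simple]
    rcases hu i1 rfl with rfl | h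
    · right
      rw [twinDrop_twinGen_le hu1.1 (by simp [i1]), map_one, mul_one]
    · left
      rw [twinMatrix_eq_two] at h
      simp only [i1] at h
      rw [twinDrop_twinGen hu1.1 hu1.2, twinShift_twinGen (by omega) (by omega)]
      congr 1
      omega
  | one => left; simp
  | mul x y _ _ hx hy =>
    have hc := (twinShift_commute (twinDrop n x)).eq
    set s := twinGen (n + 2) 1
    set X := twinShift n (twinDrop n x)
    set Y := twinShift n (twinDrop n y)
    have hXY : twinShift n (twinDrop n (x * y)) = X * Y := by simp only [map_mul, X, Y]
    rw [hXY]
    rcases hx with hx | hx <;> rcases hy with hy | hy <;> rw [hx, hy]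
    · left; rfl
    · right; rw [← mul_assoc, ← mul_assoc, hc]
    · right; rw [mul_assoc]
    · left
      rw [mul_assoc s, ← mul_assoc X, ← hc, mul_assoc s, ← mul_assoc s s, hs, one_mul]
  | inv x _ hx =>
    have hc := (twinShift_commute (twinDrop n x)).eq
    rw [map_inv, map_inv]
    rcases hx with hx | hx
    · left; rw [← hx]
    · right
      rw [← twinGen_inv (n + 2) 1, ← mul_inv_rev, ← hc, ← hx]

/-- A class-preserving automorphism of `T_{n+2}` induces one of the retract `T_n`. -/
theorem exists_induced_automorphism {n : ℕ} {f : MulAut (TwinGroup (n + 2))}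
    (hf : ClassPreserving f) : ∃ f' : MulAut (TwinGroup n), ClassPreserving f' ∧
      ∀ x, f' x = twinDrop n (f (twinShift n x)) := by
  have hfactor : ∀ F : MulAut (TwinGroup (n + 2)), ClassPreserving F → ∀ y,
      twinDrop n (F (twinShift n (twinDrop n y))) = twinDrop n (F y) := by
    intro F hF
    suffices h : ((twinDrop n).comp F.toMonoidHom).comp ((twinShift n).comp (twinDrop n)) =
        (twinDrop n).comp F.toMonoidHom from fun y => DFunLike.congr_fun h y
    apply twin_hom_ext
    intro i h1 h2
    simp only [MonoidHom.comp_apply]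
    by_cases hi : i ≤ 2
    · rw [twinDrop_twinGen_le h1 hi, map_one, map_one, map_one]
      obtain ⟨c, hc⟩ := isConj_iff.1 (hF i h1 h2)
      change 1 = twinDrop n (F (twinGen (n + 2) i))
      rw [← hc, map_mul, map_mul, twinDrop_twinGen_le h1 hi, mul_one, ← map_mul, mul_inv_cancel,
        map_one]
    · rw [twinDrop_twinGen h1 h2, twinShift_twinGen (by omega) (by omega)]
      congr 3
      omega
  have hfinv : ClassPreserving f⁻¹ := fun i h1 h2 => isConj_inv_apply (hf i h1 h2)
  let a : TwinGroup n →* TwinGroup n := ((twinDrop n).comp f.toMonoidHom).comp (twinShift n)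
  let b : TwinGroup n →* TwinGroup n := ((twinDrop n).comp f⁻¹.toMonoidHom).comp (twinShift n)
  have ha : ∀ x, a x = twinDrop n (f (twinShift n x)) := fun _ => rfl
  have hb : ∀ x, b x = twinDrop n (f⁻¹ (twinShift n x)) := fun _ => rfl
  refine ⟨MonoidHom.toMulEquiv a b ?_ ?_, ?_, ha⟩
  · ext1 x
    rw [MonoidHom.comp_apply, ha, hb, hfactor _ hfinv, MulAut.inv_apply_self, twinDrop_twinShift]
    rfl
  · ext1 x
    rw [MonoidHom.comp_apply, ha, hb, hfactor _ hf, MulAut.apply_inv_self, twinDrop_twinShift]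
    rfl
  · intro i h1 h2
    have := (twinDrop n).map_isConj (hf (i + 2) (by omega) (by omega))
    rw [twinDrop_twinGen (by omega) (by omega), Nat.add_sub_cancel] at this
    change IsConj _ (twinDrop n (f (twinShift n (twinGen n i))))
    rw [twinShift_twinGen h1 h2]
    exact this

/-- If class-preserving automorphisms of `T_n` are inner, then every class-preserving automorphism
of `T_{n+2}` can be modified by an inner one so as to fix all generators except possibly `s_2`. -/
theorem exists_conj_mul_fix {n : ℕ}
    (ih : ∀ f : MulAut (TwinGroup n), ClassPreserving f → f ∈ InnerAut (TwinGroup n))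
    {f : MulAut (TwinGroup (n + 2))} (hf : ClassPreserving f) :
    ∃ h : TwinGroup (n + 2), ∀ i, 1 ≤ i → i < n + 2 → i ≠ 2 →
      (MulAut.conj h * f) (twinGen (n + 2) i) = twinGen (n + 2) i := by
  obtain ⟨c, hc⟩ := isConj_iff.1 (hf 1 le_rfl (by omega))
  set f₁ := MulAut.conj c⁻¹ * f with hf₁
  have hf₁c : ClassPreserving f₁ := hf.conj_mul _
  have hf₁1 : f₁ (twinGen (n + 2) 1) = twinGen (n + 2) 1 := by
    rw [hf₁, MulAut.mul_apply, ← hc, MulAut.conj_apply]; group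
  obtain ⟨f', hf', hf'a⟩ := exists_induced_automorphism hf₁c
  obtain ⟨h, hh⟩ := ih f' hf'
  set f₂ := MulAut.conj (twinShift n h⁻¹) * f₁ with hf₂
  have hf₂c : ClassPreserving f₂ := hf₁c.conj_mul _
  have hf₂1 : f₂ (twinGen (n + 2) 1) = twinGen (n + 2) 1 := by
    rw [hf₂, MulAut.mul_apply, hf₁1, MulAut.conj_apply, ← (twinShift_commute h⁻¹).eq,
      mul_inv_cancel_right]
  refine ⟨twinShift n h⁻¹ * c⁻¹, fun i h1 h2 hi => ?_⟩
  rw [map_mul, mul_assoc, ← hf₁, ← hf₂]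
  by_cases hi1 : i = 1
  · rw [hi1, hf₂1]
  have hcomm : Commute (f₂ (twinGen (n + 2) i)) (twinGen (n + 2) 1) := by
    have := (twinGen_comm (n := n + 2) (i := i) (j := 1) (by omega)).map f₂
    rwa [hf₂1] at this
  have hdrop : twinDrop n (f₂ (twinGen (n + 2) i)) = twinGen n (i - 2) := by
    have e1 : twinShift n (twinGen n (i - 2)) = twinGen (n + 2) i := by
      rw [twinShift_twinGen (by omega) (by omega)]; congr 1; omega
    have e2 := hf'a (twinGen n (i - 2))
    rw [e1, ← hh, MulAut.conj_apply] at e2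
    rw [hf₂, MulAut.mul_apply, MulAut.conj_apply, map_mul, map_mul, map_inv (twinDrop n),
      twinDrop_twinShift, ← e2]
    group
  have hshift : twinShift n (twinGen n (i - 2)) = twinGen (n + 2) i := by
    rw [twinShift_twinGen (by omega) (by omega)]
    congr 1
    omega
  rcases eq_shift_drop_of_commute hcomm with h | h
  · rw [h, hdrop, hshift]
  · exfalso
    have hv := twinVec_eq_of_isConj (hf₂c i h1 h2)
    rw [h, hdrop, hshift, twinVec_mul, twinVec_twinGen h1 h2, twinVec_twinGen le_rfl (by omega)]
      at hv
    have := congrFun hv 1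
    simp [Ne.symm hi1] at this

/-- The retraction of `T_n` onto `⟨s_1, s_2⟩`. -/
def twinRetract (n : ℕ) : TwinGroup n →* TwinGroup n :=
  twinLift n (fun i => if i ≤ 2 then twinGen n i else 1)
    (fun i _ _ => by
      split_ifs
      · exact twinGen_mul_self _ _
      · exact one_mul 1)
    (fun i j _ _ _ => by
      rw [if_neg (by omega : ¬ j ≤ 2), mul_one, one_mul])

theorem twinRetract_twinGen {n i : ℕ} (h1 : 1 ≤ i) (h2 : i < n) :
    twinRetract n (twinGen n i) = if i ≤ 2 then twinGen n i else 1 := twinLift_twinGen _ _ h1 h2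

theorem twinRetract_commute {n i : ℕ} (hi : 4 ≤ i) (x : TwinGroup n) :
    Commute (twinGen n i) (twinRetract n x) := by
  have : (MulAut.conj (twinGen n i)).toMonoidHom.comp (twinRetract n) = twinRetract n := by
    apply twin_hom_ext
    intro j h1 h2
    simp only [MonoidHom.comp_apply, twinRetract_twinGen h1 h2]
    split_ifs
    · change twinGen n i * twinGen n j * (twinGen n i)⁻¹ = _
      exact mul_inv_eq_of_eq_mul (twinGen_comm (by omega)).eq
    · exact map_one _
  have h := DFunLike.congr_fun this x
  change twinGen n i * twinRetract n x * (twinGen n i)⁻¹ = _ at h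
  exact mul_inv_eq_iff_eq_mul.1 h

/-- For `n ≥ 5`, an element that commutes with `s_4, …, s_{n-1}` lies in `⟨s_1, s_2⟩`, up to a
factor `s_4` that can only occur for `n = 5`. -/
theorem eq_retract_of_commute {n : ℕ} (hn : 5 ≤ n) {z : TwinGroup n}
    (hz : ∀ i, 4 ≤ i → i < n → Commute z (twinGen n i)) :
    z = twinRetract n z ∨ z = twinRetract n z * twinGen n 4 := by
  have hmem := (twinSystem n).mem_closure_of_commute (twinMatrix_isRightAngled _)
    {i | 4 ≤ (i : ℕ)} (z := z) (fun i hi => by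
      rw [twinSystem_simple]
      exact hz i hi i.2.2)
  have hs := twinGen_mul_self n 4
  clear hz
  induction hmem using Subgroup.closure_induction with
  | mem x hx =>
    obtain ⟨u, hu, rfl⟩ := hx
    have hu1 := u.2
    have hu' : ∀ i, 4 ≤ i → i < n → (u : ℕ) = i ∨ (u : ℕ) + 2 ≤ i ∨ i + 2 ≤ u := by
      intro i h1 h2
      rcases hu ⟨i, by omega, h2⟩ h1 with h | h
      · left; rw [h]
      · right; rw [twinMatrix_eq_two] at h; exact h
    have h3 : (u : ℕ) ≤ 2 ∨ (u : ℕ) = 4 := by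
      by_contra hcon
      have a := hu' 4 le_rfl (by omega)
      have b := hu' (u - 1)
      omega
    rw [twinSystem_simple, twinRetract_twinGen hu1.1 hu1.2]
    rcases h3 with h | h
    · left; rw [if_pos h]
    · right; rw [h, if_neg (by omega), one_mul]
  | one => left; simp
  | mul x y _ _ hx hy =>
    have hc := (twinRetract_commute le_rfl y).eq
    rw [map_mul]
    set s := twinGen n 4
    set X := twinRetract n x
    set Y := twinRetract n y
    rcases hx with hx | hx <;> rcases hy with hy | hy <;> rw [hx, hy]
    · left; rfl
    · right; rw [mul_assoc]
    · right; rw [mul_assoc, hc, mul_assoc]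
    · left; rw [mul_assoc, ← mul_assoc s, hc, mul_assoc, hs, mul_one]
  | inv x _ hx =>
    have hc := (twinRetract_commute le_rfl x).eq
    rw [map_inv]
    rcases hx with hx | hx
    · left; rw [← hx]
    · right
      rw [← twinGen_inv n 4, ← mul_inv_rev, hc, ← hx]

/-- The geometric representation of the twin group. -/
noncomputable def twinRep (n : ℕ) : TwinGroup n →* Module.End ℤ (TwinIndex n → ℤ) :=
  (twinSystem n).geomRep (twinMatrix_isRightAngled n)

theorem twinRep_retract_apply_eq_zero {n : ℕ} (x : TwinGroup n) {v : TwinIndex n → ℤ}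
    (hv : ∀ k : TwinIndex n, 3 ≤ (k : ℕ) → v k = 0) (k : TwinIndex n) (hk : 3 ≤ (k : ℕ)) :
    twinRep n (twinRetract n x) v k = 0 := by
  induction x using (twinSystem n).simple_induction_left with
  | one => simpa using hv k hk
  | mul_simple_left w i ih =>
    rw [map_mul, twinSystem_simple, twinRetract_twinGen i.2.1 i.2.2]
    split_ifs with hi
    · rw [← twinSystem_simple, twinRep, CoxeterSystem.geomRep_mul, CoxeterSystem.geomRep_simple]
      have : k ≠ i := by rintro rfl; omega
      simpa [simpleRoot, this, twinRep] using ih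
    · rw [one_mul]; exact ih

/-- The commutation with `s_4, …, s_{n-1}` confines the root of `f(s_2)` to the span of the first
two simple roots. -/
theorem exists_conjugator_of_fix {n : ℕ} (hn : 5 ≤ n) {f : MulAut (TwinGroup n)}
    (hf : ClassPreserving f) (hfix : ∀ i, 1 ≤ i → i < n → i ≠ 2 → f (twinGen n i) = twinGen n i) :
    ∃ g, f (twinGen n 2) = g * twinGen n 2 * g⁻¹ ∧
      ∀ k : TwinIndex n, 3 ≤ (k : ℕ) → twinRep n g (simpleRoot ⟨2, by omega⟩) k = 0 := by
  obtain ⟨c, hc⟩ := isConj_iff.1 (hf 2 (by omega) (by omega))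
  have hret : twinRetract n (f (twinGen n 2)) =
      twinRetract n c * twinGen n 2 * (twinRetract n c)⁻¹ := by
    rw [← hc, map_mul, map_mul, map_inv, twinRetract_twinGen (by omega) (by omega), if_pos le_rfl]
  refine ⟨twinRetract n c, ?_, fun k hk => twinRep_retract_apply_eq_zero c ?_ k hk⟩
  · rw [← hret]
    refine (eq_retract_of_commute hn fun i h1 h2 => ?_).resolve_right fun h => ?_
    · have := (twinGen_comm (n := n) (i := 2) (j := i) (by omega)).map f
      rwa [hfix i (by omega) h2 (by omega)] at this
    · have hv := twinVec_eq_of_isConj (hf 2 (by omega) (by omega))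
      rw [h, hret, twinVec_mul, twinVec_conj, twinVec_twinGen (by omega) (by omega),
        twinVec_twinGen (by omega) (by omega)] at hv
      simpa using congrFun hv 4
  · intro k hk
    have : k ≠ ⟨2, by omega⟩ := fun h => by
      have := congrArg Subtype.val h
      simp only at this
      omega
    simp [simpleRoot, this]

theorem twinRep_mul {n : ℕ} (g h : TwinGroup n) (v : TwinIndex n → ℤ) :
    twinRep n (g * h) v = twinRep n g (twinRep n h v) :=
  CoxeterSystem.geomRep_mul _ _ _ _ _

/-- The pairing with a simple root `α_i`, `i ≠ 2`, of a vector in which `2` is the only neighbour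
of `i` that may occur. -/
theorem form_simpleRoot_of_support {n : ℕ} {i t : TwinIndex n} (hit : i ≠ t) {v : TwinIndex n → ℤ}
    (hv : ∀ j, twinMatrix n i j = 0 → j ≠ t → v j = 0) :
    (twinMatrix n).form (simpleRoot i) v = v i + (twinMatrix n).gram i t * v t := by
  rw [form_simpleRoot_left, Finset.sum_eq_add i t hit]
  · simp [CoxeterMatrix.gram]
  · intro j _ hj
    rcases twinMatrix_isRightAngled n i j hj.1.symm with h | h
    · simp [CoxeterMatrix.gram, hj.1.symm, h]
    · rw [hv j h hj.2, mul_zero]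
  · simp
  · simp

/-- The index of the generator `s_2`. -/
abbrev twoIndex {n : ℕ} (hn : 3 ≤ n) : TwinIndex n := ⟨2, by omega⟩

/-- The root `g α_2`, whose reflection is `g s_2 g⁻¹`. -/
noncomputable def twinRoot {n : ℕ} (hn : 3 ≤ n) (g : TwinGroup n) : TwinIndex n → ℤ :=
  twinRep n g (simpleRoot (twoIndex hn))

theorem twinRoot_mul_two {n : ℕ} (hn : 3 ≤ n) (g : TwinGroup n) :
    twinRoot hn (g * twinGen n 2) = -twinRoot hn g := by
  have e : twinRep n (twinGen n 2) (simpleRoot (twoIndex hn)) = -simpleRoot (twoIndex hn) := by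
    rw [← twinSystem_simple (twoIndex hn), twinRep, CoxeterSystem.geomRep_simple_self]
  rw [twinRoot, twinRep_mul, e, map_neg, twinRoot]

theorem twinRoot_mul_left {n : ℕ} (hn : 3 ≤ n) (a : TwinIndex n) (g : TwinGroup n) :
    twinRoot hn (twinGen n a * g) = twinRoot hn g -
      (2 * (twinMatrix n).form (simpleRoot a) (twinRoot hn g)) • simpleRoot a := by
  rw [twinRoot, twinRep_mul, ← twinRoot, ← twinSystem_simple]
  exact CoxeterSystem.geomRep_simple _ _ _ _

theorem twinRoot_two_odd {n : ℕ} (hn : 3 ≤ n) (g : TwinGroup n) :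
    ∃ m, twinRoot hn g (twoIndex hn) = 2 * m + 1 := by
  obtain ⟨m, hm⟩ := (twinSystem n).two_dvd_geomRep_sub (twinMatrix_isRightAngled n) g
    (simpleRoot (twoIndex hn)) (twoIndex hn)
  rw [← twinRep, ← twinRoot] at hm
  simp only [simpleRoot, Pi.single_eq_same] at hm
  exact ⟨m, by omega⟩

theorem twinRoot_even_of_ne_two {n : ℕ} (hn : 3 ≤ n) (g : TwinGroup n) {i : TwinIndex n}
    (hi : (i : ℕ) ≠ 2) : ∃ m, twinRoot hn g i = 2 * m := by
  obtain ⟨m, hm⟩ := (twinSystem n).two_dvd_geomRep_sub (twinMatrix_isRightAngled n) g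
    (simpleRoot (twoIndex hn)) i
  have h1 : i ≠ (twoIndex hn) := fun h' => hi (congrArg Subtype.val h')
  rw [← twinRep, ← twinRoot] at hm
  refine ⟨m, ?_⟩
  rw [← hm]
  simp [simpleRoot, h1]

theorem twinRoot_nonneg_of_two_pos {n : ℕ} (hn : 3 ≤ n) {g : TwinGroup n}
    (h : 0 < twinRoot hn g (twoIndex hn)) : 0 ≤ twinRoot hn g := by
  refine ((twinSystem n).geomRep_nonneg_or_nonpos (twinMatrix_isRightAngled n) g _).resolve_right
    fun h' => ?_
  exact absurd h (not_lt.2 (h' _))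

/-- The automorphism `f` fixes all generators except possibly `s_2`, which it sends to the
reflection `g s_2 g⁻¹` in the root `g α_2`; for `n ≥ 5` this root is required to lie in the span of
`α_1` and `α_2`. -/
structure FixesAllButTwo {n : ℕ} (hn : 3 ≤ n) (f : MulAut (TwinGroup n)) (g : TwinGroup n) :
    Prop where
  fix : ∀ i, 1 ≤ i → i < n → i ≠ 2 → f (twinGen n i) = twinGen n i
  map_two : f (twinGen n 2) = g * twinGen n 2 * g⁻¹
  support : 5 ≤ n → ∀ k : TwinIndex n, 3 ≤ (k : ℕ) → twinRoot hn g k = 0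

namespace FixesAllButTwo

variable {n : ℕ} {hn : 3 ≤ n} {f : MulAut (TwinGroup n)} {g : TwinGroup n}

theorem form_eq (h : FixesAllButTwo hn f g) {i : TwinIndex n} (hi : (i : ℕ) ≠ 2) :
    (twinMatrix n).form (simpleRoot i) (twinRoot hn g) =
      twinRoot hn g i + (twinMatrix n).gram i (twoIndex hn) * twinRoot hn g (twoIndex hn) := by
  refine form_simpleRoot_of_support (fun h' => hi (by rw [h'])) fun j hj hj2 => ?_
  rw [twinMatrix_eq_zero] at hj
  have hj2' : (j : ℕ) ≠ 2 := fun h' => hj2 (Subtype.ext h')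
  have := j.2
  have := i.2
  exact h.support (by omega) j (by omega)

/-- The situation persists under conjugation by a generator other than `s_2` that commutes with all
generators except `s_2`, that is, by `s_1`, or by `s_3` in `T_4`. -/
theorem conj_mul (h : FixesAllButTwo hn f g) {a : TwinIndex n}
    (ha : (a : ℕ) = 1 ∨ n = 4 ∧ (a : ℕ) = 3) :
    FixesAllButTwo hn (MulAut.conj (twinGen n a) * f) (twinGen n a * g) where
  fix i h1 h2 hi := by
    rw [MulAut.mul_apply, h.fix i h1 h2 hi, MulAut.conj_apply]
    exact mul_inv_eq_of_eq_mul (twinGen_comm (by omega)).eq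
  map_two := by
    rw [MulAut.mul_apply, h.map_two, MulAut.conj_apply]; group
  support h5 k hk := by
    have hka : k ≠ a := by rintro rfl; omega
    rw [twinRoot_mul_left]
    simpa [simpleRoot, hka] using h.support h5 k hk

theorem mul_two (h : FixesAllButTwo hn f g) : FixesAllButTwo hn f (g * twinGen n 2) where
  fix := h.fix
  map_two := by rw [h.map_two]; group
  support h5 k hk := by
    rw [twinRoot_mul_two, Pi.neg_apply, h.support h5 k hk, neg_zero]

/-- Changing the coefficient of the root at `a` by conjugation with `s_a`. -/
theorem coeff_conj (h : FixesAllButTwo hn f g) {a : TwinIndex n}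
    (ha : (a : ℕ) = 1 ∨ n = 4 ∧ (a : ℕ) = 3) (k : TwinIndex n) :
    twinRoot hn (twinGen n a * g) k =
      if k = a then 2 * twinRoot hn g (twoIndex hn) - twinRoot hn g a
      else twinRoot hn g k := by
  have hgram : (twinMatrix n).gram a (twoIndex hn) = -1 := by
    have h1 : a ≠ (twoIndex hn) := fun h' => by
      have := congrArg Subtype.val h'
      simp only at this
      omega
    have h2 : twinMatrix n a (twoIndex hn) ≠ 2 := by
      rw [Ne, twinMatrix_eq_two]; simp only; omega
    simp [CoxeterMatrix.gram, h1, h2]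
  rw [twinRoot_mul_left, h.form_eq (by omega), hgram]
  by_cases hk : k = a
  · subst hk; simp [simpleRoot]; ring
  · simp [simpleRoot, hk]

/-- If the coefficients at the neighbours of `2` do not exceed the one at `2`, then the simple roots
and the root of `f(s_2)` pair nonpositively, and rigidity applies. -/
theorem eq_one (h : FixesAllButTwo hn f g)
    (hpos : 0 < twinRoot hn g (twoIndex hn))
    (hle : ∀ a : TwinIndex n, (a : ℕ) = 1 ∨ (a : ℕ) = 3 →
      twinRoot hn g a ≤ twinRoot hn g (twoIndex hn)) : f = 1 := by
  have hf2 : f ((twinSystem n).simple (twoIndex hn)) = (twinSystem n).simple (twoIndex hn) := by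
    refine (twinSystem n).map_simple_eq_of_positive_root (twinMatrix_isRightAngled n) f
      (twoIndex hn) ?_ g ?_ (twinRoot_nonneg_of_two_pos hn hpos) ?_ ?_
    · intro i hi
      rw [twinSystem_simple]
      exact h.fix i i.2.1 i.2.2 fun h' => hi (Subtype.ext h')
    · rw [twinSystem_simple]; exact h.map_two
    · intro i hi hi2
      have hne : (i : ℕ) ≠ 2 := fun h' => hi (Subtype.ext h')
      have hgram : (twinMatrix n).gram i (twoIndex hn) = 0 := by
        simp [CoxeterMatrix.gram, hi, hi2]
      have := i.2
      rw [twinMatrix_eq_two] at hi2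
      simp only at hi2
      have := h.form_eq hne
      rw [hgram, zero_mul, add_zero, h.support (by omega) i (by omega)] at this
      exact this
    · intro i hi0
      have hne : (i : ℕ) ≠ 2 := by
        rw [twinMatrix_eq_zero] at hi0; simp only at hi0; omega
      have hne' : i ≠ (twoIndex hn) := fun h' => hne (congrArg Subtype.val h')
      have hgram : (twinMatrix n).gram i (twoIndex hn) = -1 := by
        simp [CoxeterMatrix.gram, hne', hi0]
      have hform := h.form_eq hne
      rw [hgram] at hform
      rw [twinMatrix_eq_zero] at hi0
      simp only at hi0
      have := hle i (by omega)
      obtain ⟨m, hm⟩ := twinRoot_two_odd hn g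
      obtain ⟨m', hm'⟩ := twinRoot_even_of_ne_two hn g hne
      change (twinMatrix n).form (simpleRoot i) (twinRoot hn g) ≤ -1
      rw [hform]
      omega
  refine twin_aut_ext fun i h1 h2 => ?_
  by_cases hi : i = 2
  · subst hi; rwa [twinSystem_simple] at hf2
  · exact h.fix i h1 h2 hi

theorem mem_innerAut (h : FixesAllButTwo hn f g) : f ∈ InnerAut (TwinGroup n) := by
  -- Replacing `g` by `g s_2` changes the sign of the root, whose coefficient at `2` is odd.
  wlog hpos : 0 < twinRoot hn g (twoIndex hn) generalizing g
  · refine this h.mul_two ?_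
    obtain ⟨m, hm⟩ := twinRoot_two_odd hn g
    rw [twinRoot_mul_two, Pi.neg_apply]
    omega
  -- Conjugation with `s_1` replaces the coefficient `x` at `1` by `2y - x`, where `y` is the one at
  -- `2`; one of `x` and `2y - x` is at most `y`.
  wlog h1 : twinRoot hn g ⟨1, by omega⟩ ≤ twinRoot hn g (twoIndex hn) generalizing g f
  · have hc := h.coeff_conj (a := ⟨1, by omega⟩) (Or.inl rfl)
    refine mem_innerAut_of_conj_mul (this (h.conj_mul (a := ⟨1, by omega⟩) (Or.inl rfl)) ?_ ?_)
    · rw [hc, if_neg (by simp)]; exact hpos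
    · rw [hc, hc, if_pos rfl, if_neg (by simp)]; omega
  by_cases h4 : n = 4
  · wlog h3 : twinRoot hn g ⟨3, by omega⟩ ≤ twinRoot hn g (twoIndex hn) generalizing g f
    · have hc := h.coeff_conj (a := ⟨3, by omega⟩) (Or.inr ⟨h4, rfl⟩)
      refine mem_innerAut_of_conj_mul
        (this (h.conj_mul (a := ⟨3, by omega⟩) (Or.inr ⟨h4, rfl⟩)) ?_ ?_ ?_)
      · rw [hc, if_neg (by simp)]; exact hpos
      · rw [hc, hc, if_neg (by simp), if_neg (by simp)]; exact h1
      · rw [hc, hc, if_pos rfl, if_neg (by simp)]; omega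
    rw [h.eq_one hpos fun a ha => ?_]
    · exact one_mem _
    · rcases ha with ha | ha
      · have : a = ⟨1, by omega⟩ := Subtype.ext ha
        rw [this]; exact h1
      · have : a = ⟨3, by omega⟩ := Subtype.ext ha
        rw [this]; exact h3
  · rw [h.eq_one hpos fun a ha => ?_]
    · exact one_mem _
    · rcases ha with ha | ha
      · have : a = ⟨1, by omega⟩ := Subtype.ext ha
        rw [this]; exact h1
      · have := a.2
        rw [h.support (by omega) a (by omega)]
        exact hpos.le

end FixesAllButTwo

/-- Induction in steps of two; the retraction `twinDrop` settles everything except the image of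
`s_2`, and the root of that image is then handled by `FixesAllButTwo.mem_innerAut`. -/
theorem ClassPreserving.mem_innerAut {n : ℕ} {f : MulAut (TwinGroup n)} (hf : ClassPreserving f) :
    f ∈ InnerAut (TwinGroup n) := by
  induction n using Nat.strong_induction_on with
  | _ n ih =>
  by_cases hn2 : n < 2
  · have : f = 1 := twin_aut_ext fun i h1 h2 => by omega
    rw [this]; exact one_mem _
  obtain ⟨m, rfl⟩ : ∃ m, n = m + 2 := ⟨n - 2, by omega⟩
  obtain ⟨h, hh⟩ := exists_conj_mul_fix (fun f' hf' => ih m (by omega) hf') hf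
  apply mem_innerAut_of_conj_mul (h := h)
  have hcp := hf.conj_mul h
  by_cases hm : m = 0
  · have : MulAut.conj h * f = 1 := twin_aut_ext fun i h1 h2 => hh i h1 h2 (by omega)
    rw [this]; exact one_mem _
  by_cases h5 : 5 ≤ m + 2
  · obtain ⟨g, hg1, hg2⟩ := exists_conjugator_of_fix h5 hcp hh
    exact FixesAllButTwo.mem_innerAut (hn := by omega) ⟨hh, hg1, fun _ => hg2⟩
  · obtain ⟨g, hg⟩ := isConj_iff.1 (hcp 2 (by omega) (by omega))
    exact FixesAllButTwo.mem_innerAut (hn := by omega) ⟨hh, hg.symm, fun h => absurd h h5⟩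

/-- An automorphism of a twin group is determined, up to an inner one, by its action on exponent
vectors modulo 2. -/
theorem inv_mul_mem_innerAut {n : ℕ} {f h : MulAut (TwinGroup n)}
    (hfh : ∀ i, 1 ≤ i → i < n → twinVec (f (twinGen n i)) = twinVec (h (twinGen n i))) :
    h⁻¹ * f ∈ InnerAut (TwinGroup n) := by
  refine ClassPreserving.mem_innerAut fun i h1 h2 => isConj_of_involution ?_ h1 h2 ?_
  · rw [← map_mul, twinGen_mul_self, map_one]
  · rw [MulAut.mul_apply, twinVec_map, hfh i h1 h2, ← twinVec_map, MulAut.inv_apply_self]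

/-! ### Automorphisms on exponent vectors -/

theorem twinVec_eq_zero_of_notMem {n : ℕ} (x : TwinGroup n) {p : ℕ} (hp : ¬(1 ≤ p ∧ p < n)) :
    twinVec x p = 0 := by
  have h := congrFun (twinVec_map (1 : MulAut (TwinGroup n)) x) p
  rw [MulAut.one_apply] at h
  rw [h, Finset.sum_apply]
  refine Finset.sum_eq_zero fun i hi => ?_
  rw [Finset.mem_range] at hi
  rw [MulAut.one_apply]
  by_cases h1 : 1 ≤ i
  · have : p ≠ i := by omega
    rw [twinVec_twinGen h1 hi]; simp [this]
  · rw [twinGen_eq_one (by omega), twinVec_one]; simp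

theorem twinVec_eq_zero_of_map {n : ℕ} (f : MulAut (TwinGroup n)) {x : TwinGroup n}
    (h : twinVec (f x) = 0) : twinVec x = 0 := by
  have := twinVec_map f⁻¹ (f x)
  rw [MulAut.inv_apply_self, h] at this
  simpa using this

theorem twinVec_map_twinGen_ne_zero {n : ℕ} (f : MulAut (TwinGroup n)) {i : ℕ} (h1 : 1 ≤ i)
    (h2 : i < n) : ∃ p, (1 ≤ p ∧ p < n) ∧ twinVec (f (twinGen n i)) p ≠ 0 := by
  by_contra hcon
  push Not at hcon
  have h0 : twinVec (f (twinGen n i)) = 0 := by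
    funext p
    by_cases hp : 1 ≤ p ∧ p < n
    · exact hcon p hp
    · exact twinVec_eq_zero_of_notMem _ hp
  have := twinVec_eq_zero_of_map f h0
  rw [twinVec_twinGen h1 h2] at this
  simpa using congrFun this i

theorem twinVec_map_twinGen_ne {n : ℕ} (f : MulAut (TwinGroup n)) {i j : ℕ} (hij : i ≠ j)
    (hi : 1 ≤ i ∧ i < n) (hj : 1 ≤ j ∧ j < n) :
    ∃ p, (1 ≤ p ∧ p < n) ∧ twinVec (f (twinGen n i)) p ≠ twinVec (f (twinGen n j)) p := by
  by_contra hcon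
  push Not at hcon
  have h0 : twinVec (f (twinGen n i * twinGen n j)) = 0 := by
    funext p
    rw [map_mul, twinVec_mul, Pi.add_apply]
    by_cases hp : 1 ≤ p ∧ p < n
    · rw [hcon p hp]; exact CharTwo.add_self_eq_zero _
    · rw [twinVec_eq_zero_of_notMem _ hp, twinVec_eq_zero_of_notMem _ hp, add_zero]
      rfl
  have := twinVec_eq_zero_of_map f h0
  rw [twinVec_mul, twinVec_twinGen hi.1 hi.2, twinVec_twinGen hj.1 hj.2] at this
  simpa [hij] using congrFun this i

theorem zmod_two_eq_one {a : ZMod 2} (h : a ≠ 0) : a = 1 := by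
  revert a; decide

/-- The images of commuting generators have supports without neighbouring elements, because
`f(s_i)`, `f(s_j)` and `f(s_i s_j)` all are involutions. -/
theorem twinVec_map_eq_zero_or {n : ℕ} (f : MulAut (TwinGroup n)) {i j p q : ℕ}
    (hij : i + 1 ≠ j ∧ j + 1 ≠ i) (hp : 1 ≤ p ∧ p < n) (hq : 1 ≤ q ∧ q < n)
    (hpq : p + 1 = q ∨ q + 1 = p) :
    twinVec (f (twinGen n i)) p = 0 ∨ twinVec (f (twinGen n j)) q = 0 := by
  have hinv : ∀ x : TwinGroup n, x * x = 1 → f x * f x = 1 := fun x hx => by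
    rw [← map_mul, hx, map_one]
  have h1 := twinVec_eq_zero_of_involution (hinv _ (twinGen_mul_self n i)) hp hq hpq
  have h2 := twinVec_eq_zero_of_involution (hinv _ (twinGen_mul_self n j)) hp hq hpq
  have h3 := twinVec_eq_zero_of_involution (hinv (twinGen n i * twinGen n j) (by
    rw [mul_assoc, ← mul_assoc (twinGen n j), ← (twinGen_comm hij).eq, mul_assoc,
      twinGen_mul_self, mul_one, twinGen_mul_self])) hp hq hpq
  rw [map_mul, twinVec_mul, Pi.add_apply, Pi.add_apply] at h3
  generalize twinVec (f (twinGen n i)) p = a at *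
  generalize twinVec (f (twinGen n i)) q = a' at *
  generalize twinVec (f (twinGen n j)) p = b at *
  generalize twinVec (f (twinGen n j)) q = b' at *
  revert a a' b b'
  decide

/-- The images of the generators span: every unit vector is a linear combination of them. -/
theorem exists_sum_twinVec_map {n : ℕ} (f : MulAut (TwinGroup n)) {p : ℕ} (hp : 1 ≤ p ∧ p < n) :
    ∃ c : ℕ → ZMod 2, ∀ q, ∑ i ∈ Finset.Ico 1 n, c i * twinVec (f (twinGen n i)) q =
      if q = p then 1 else 0 := by
  refine ⟨twinVec (f⁻¹ (twinGen n p)), fun q => ?_⟩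
  have h := congrFun (twinVec_map f (f⁻¹ (twinGen n p))) q
  rw [MulAut.apply_inv_self, twinVec_twinGen hp.1 hp.2, Pi.single_apply, Finset.sum_apply,
    Finset.range_eq_Ico, Finset.sum_eq_sum_Ico_succ_bot (by omega)] at h
  rw [h, twinVec_eq_zero_of_notMem _ (by omega : ¬(1 ≤ 0 ∧ 0 < n))]
  simp

theorem twinVec_map_eq_one {n : ℕ} (f : MulAut (TwinGroup n)) {i p : ℕ} (hp : 1 ≤ p ∧ p < n)
    (h : ∀ j, 1 ≤ j → j < n → j ≠ i → twinVec (f (twinGen n j)) p = 0) :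
    twinVec (f (twinGen n i)) p = 1 := by
  obtain ⟨c, hc⟩ := exists_sum_twinVec_map f hp
  by_contra hne
  have h0 : twinVec (f (twinGen n i)) p = 0 := by
    by_contra h0; exact hne (zmod_two_eq_one h0)
  have := hc p
  rw [if_pos rfl, Finset.sum_eq_zero] at this
  · exact zero_ne_one this
  · intro j hj
    rw [Finset.mem_Ico] at hj
    by_cases hji : j = i
    · rw [hji, h0, mul_zero]
    · rw [h j hj.1 hj.2 hji, mul_zero]

/-- If all but one of the images vanish at a coordinate, this happens at no other coordinate for the
same exception. -/
theorem not_vanish_two {n : ℕ} (f : MulAut (TwinGroup n)) {i p q : ℕ} (hpq : p ≠ q)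
    (hp : 1 ≤ p ∧ p < n) (hq : 1 ≤ q ∧ q < n)
    (h : ∀ j, 1 ≤ j → j < n → j ≠ i →
      twinVec (f (twinGen n j)) p = 0 ∧ twinVec (f (twinGen n j)) q = 0) : False := by
  have h1 := twinVec_map_eq_one f hp fun j a b c => (h j a b c).1
  have h2 := twinVec_map_eq_one f hq fun j a b c => (h j a b c).2
  obtain ⟨c, hc⟩ := exists_sum_twinVec_map f hp
  have e : ∑ j ∈ Finset.Ico 1 n, c j * twinVec (f (twinGen n j)) p =
      ∑ j ∈ Finset.Ico 1 n, c j * twinVec (f (twinGen n j)) q := by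
    refine Finset.sum_congr rfl fun j hj => ?_
    rw [Finset.mem_Ico] at hj
    by_cases hji : j = i
    · rw [hji, h1, h2]
    · rw [(h j hj.1 hj.2 hji).1, (h j hj.1 hj.2 hji).2]
  rw [hc p, hc q, if_pos rfl, if_neg hpq.symm] at e
  exact one_ne_zero e

theorem exists_annihilator : ∀ a₁ a₂ a₃ b₁ b₂ b₃ : ZMod 2, ∃ t₁ t₂ t₃ : ZMod 2,
    (t₁ = 1 ∨ t₂ = 1 ∨ t₃ = 1) ∧ t₁ * a₁ + t₂ * a₂ + t₃ * a₃ = 0 ∧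
      t₁ * b₁ + t₂ * b₂ + t₃ * b₃ = 0 := by
  decide

/-- Two vectors do not span a space with three coordinates: it is impossible that all but two of the
images vanish at three coordinates. -/
theorem not_vanish_three {n : ℕ} (f : MulAut (TwinGroup n)) {i i' p q r : ℕ} (hpq : p ≠ q)
    (hpr : p ≠ r) (hqr : q ≠ r) (hp : 1 ≤ p ∧ p < n) (hq : 1 ≤ q ∧ q < n) (hr : 1 ≤ r ∧ r < n)
    (h : ∀ j, 1 ≤ j → j < n → j ≠ i → j ≠ i' → twinVec (f (twinGen n j)) p = 0 ∧
      twinVec (f (twinGen n j)) q = 0 ∧ twinVec (f (twinGen n j)) r = 0) : False := by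
  obtain ⟨t₁, t₂, t₃, ht, ha, hb⟩ := exists_annihilator (twinVec (f (twinGen n i)) p)
    (twinVec (f (twinGen n i)) q) (twinVec (f (twinGen n i)) r) (twinVec (f (twinGen n i')) p)
    (twinVec (f (twinGen n i')) q) (twinVec (f (twinGen n i')) r)
  have key : ∀ c : ℕ → ZMod 2,
      t₁ * ∑ j ∈ Finset.Ico 1 n, c j * twinVec (f (twinGen n j)) p +
      t₂ * ∑ j ∈ Finset.Ico 1 n, c j * twinVec (f (twinGen n j)) q +
      t₃ * ∑ j ∈ Finset.Ico 1 n, c j * twinVec (f (twinGen n j)) r = 0 := by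
    intro c
    rw [Finset.mul_sum, Finset.mul_sum, Finset.mul_sum, ← Finset.sum_add_distrib,
      ← Finset.sum_add_distrib]
    refine Finset.sum_eq_zero fun j hj => ?_
    rw [Finset.mem_Ico] at hj
    have : ∀ x y z : ZMod 2, t₁ * (c j * x) + t₂ * (c j * y) + t₃ * (c j * z) =
        c j * (t₁ * x + t₂ * y + t₃ * z) := fun x y z => by ring
    rw [this]
    by_cases hji : j = i
    · rw [hji, ha, mul_zero]
    by_cases hji' : j = i'
    · rw [hji', hb, mul_zero]
    · obtain ⟨e1, e2, e3⟩ := h j hj.1 hj.2 hji hji'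
      rw [e1, e2, e3]; ring
  rcases ht with ht | ht | ht
  · obtain ⟨c, hc⟩ := exists_sum_twinVec_map f hp
    have := key c
    rw [hc, hc, hc] at this
    simp [ht, hpq.symm, hpr.symm] at this
  · obtain ⟨c, hc⟩ := exists_sum_twinVec_map f hq
    have := key c
    rw [hc, hc, hc] at this
    simp [ht, hpq, hqr.symm] at this
  · obtain ⟨c, hc⟩ := exists_sum_twinVec_map f hr
    have := key c
    rw [hc, hc, hc] at this
    simp [ht, hpr, hqr] at this

/-- Suppose that `s_i` commutes with all generators but `s_{i'}`. Then at most one index is a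
neighbour of the support of `f(s_i)`. -/
theorem not_two_neighbours {n : ℕ} (f : MulAut (TwinGroup n)) {i i' p q p' q' : ℕ}
    (hi : ∀ j, 1 ≤ j → j < n → j ≠ i' → i + 1 ≠ j ∧ j + 1 ≠ i)
    (hp : 1 ≤ p ∧ p < n) (hq : 1 ≤ q ∧ q < n) (hpq : p + 1 = q ∨ q + 1 = p)
    (hp' : 1 ≤ p' ∧ p' < n) (hq' : 1 ≤ q' ∧ q' < n) (hpq' : p' + 1 = q' ∨ q' + 1 = p')
    (hqq : q ≠ q') (hx : twinVec (f (twinGen n i)) p ≠ 0)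
    (hx' : twinVec (f (twinGen n i)) p' ≠ 0) : False :=
  not_vanish_two f hqq hq hq' fun j h1 h2 h3 =>
    ⟨(twinVec_map_eq_zero_or f (hi j h1 h2 h3) hp hq hpq).resolve_left hx,
      (twinVec_map_eq_zero_or f (hi j h1 h2 h3) hp' hq' hpq').resolve_left hx'⟩

/-- For `n ≥ 5`, the first and the last generator are sent to conjugates of one of them. -/
theorem twinVec_map_end {n : ℕ} (hn : 5 ≤ n) (f : MulAut (TwinGroup n)) {i : ℕ}
    (hi : i = 1 ∨ i + 1 = n) : twinVec (f (twinGen n i)) = Pi.single 1 1 ∨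
      twinVec (f (twinGen n i)) = Pi.single (n - 1) 1 := by
  obtain ⟨i', hi'⟩ : ∃ i', ∀ j, 1 ≤ j → j < n → j ≠ i' → i + 1 ≠ j ∧ j + 1 ≠ i := by
    rcases hi with rfl | hi
    · exact ⟨2, by omega⟩
    · exact ⟨n - 2, by omega⟩
  have hends : ∀ p, 1 ≤ p ∧ p < n → p ≠ 1 → p + 1 ≠ n → twinVec (f (twinGen n i)) p = 0 := by
    intro p hp h1 h2
    by_contra h
    exact not_two_neighbours f hi' hp (q := p - 1) (by omega) (by omega) hp (q' := p + 1) (by omega)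
      (by omega) (by omega) h h
  have hnot : twinVec (f (twinGen n i)) 1 = 0 ∨ twinVec (f (twinGen n i)) (n - 1) = 0 := by
    by_contra h
    push Not at h
    exact not_two_neighbours f hi' (p := 1) (by omega) (q := 2) (by omega) (by omega) (p' := n - 1)
      (by omega) (q' := n - 2) (by omega) (by omega) (by omega) h.1 h.2
  obtain ⟨p, hp, hp0⟩ := twinVec_map_twinGen_ne_zero f (i := i) (by omega) (by omega)
  have hp' : p = 1 ∨ p = n - 1 := by
    by_contra h
    exact hp0 (hends p hp (by omega) (by omega))
  have hzero : ∀ q, q ≠ p → twinVec (f (twinGen n i)) q = 0 := by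
    intro q hqp
    by_cases hq : 1 ≤ q ∧ q < n
    · by_cases hqe : q ≠ 1 ∧ q + 1 ≠ n
      · exact hends q hq hqe.1 hqe.2
      · rcases hp' with rfl | rfl
        · have : q = n - 1 := by omega
          rw [this]; exact hnot.resolve_left hp0
        · have : q = 1 := by omega
          rw [this]; exact hnot.resolve_right hp0
    · exact twinVec_eq_zero_of_notMem _ hq
  have : twinVec (f (twinGen n i)) = Pi.single p 1 := by
    funext q
    by_cases hq : q = p
    · rw [hq, Pi.single_eq_same]; exact zmod_two_eq_one hp0
    · rw [Pi.single_eq_of_ne hq]; exact hzero q hq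
  rcases hp' with h | h
  · left; rw [this, h]
  · right; rw [this, h]

/-- If the image of the first generator has the exponent vector of that generator, then the exponent
vectors of the images of the inner generators are the expected ones, except possibly for the
occurrence of `s_1` in the image of `s_3` and of `s_{n-1}` in that of `s_{n-3}`. -/
theorem twinVec_map_middle {n : ℕ} (hn : 5 ≤ n) (f : MulAut (TwinGroup n))
    (h1 : twinVec (f (twinGen n 1)) = Pi.single 1 1) (i : ℕ) (hi : 2 ≤ i)
    (hin : i + 2 ≤ n) : twinVec (f (twinGen n i)) i = 1 ∧
      ∀ p, twinVec (f (twinGen n i)) p ≠ 0 → p = i ∨ (i = 3 ∧ p = 1) ∨ (i + 3 = n ∧ p + 1 = n) := by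
  induction i using Nat.strong_induction_on with
  | _ i ih =>
  -- The information on smaller indices, now including the index 1.
  have hsmall : ∀ j, 1 ≤ j → j < i → twinVec (f (twinGen n j)) j = 1 ∧
      twinVec (f (twinGen n j)) i = 0 := by
    intro j hj1 hji
    by_cases hj : j = 1
    · subst hj
      rw [h1]
      have : i ≠ 1 := by omega
      simp [this]
    · obtain ⟨a, b⟩ := ih j hji (by omega) (by omega)
      refine ⟨a, ?_⟩
      by_contra hcon
      have := b i hcon
      omega
  have hii : twinVec (f (twinGen n i)) i = 1 := by
    refine twinVec_map_eq_one f (by omega) fun j hj1 hj2 hji => ?_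
    by_cases hlt : j < i
    · exact (hsmall j hj1 hlt).2
    · refine (twinVec_map_eq_zero_or f (i := i - 1) (p := i - 1) (by omega) (by omega) (by omega)
        (by omega)).resolve_left ?_
      rw [(hsmall (i - 1) (by omega) (by omega)).1]
      exact one_ne_zero
  refine ⟨hii, fun p hp => ?_⟩
  have hpn : 1 ≤ p ∧ p < n := by
    by_contra h
    exact hp (twinVec_eq_zero_of_notMem _ h)
  have hne : twinVec (f (twinGen n i)) i ≠ 0 := by rw [hii]; exact one_ne_zero
  have hneigh : ∀ q, 1 ≤ q ∧ q < n → (p + 1 = q ∨ q + 1 = p) → q = i - 1 ∨ q = i + 1 := by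
    intro q hq hpq
    by_contra hcon
    -- The images of the generators commuting with `s_i` vanish at `i - 1`, `i + 1` and `q`, but
    -- only two generators do not commute with `s_i`.
    refine not_vanish_three f (i := i - 1) (i' := i + 1) (p := i - 1) (q := i + 1) (r := q)
      (by omega) (by omega) (by omega) (by omega) (by omega) hq fun j hj1 hj2 hj3 hj4 => ?_
    have hcomm : i + 1 ≠ j ∧ j + 1 ≠ i := by omega
    exact ⟨(twinVec_map_eq_zero_or f hcomm (by omega) (by omega) (by omega)).resolve_left hne,
      (twinVec_map_eq_zero_or f hcomm (by omega) (by omega) (by omega)).resolve_left hne,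
      (twinVec_map_eq_zero_or f hcomm hpn hq hpq).resolve_left hp⟩
  have a := hneigh (p - 1)
  have b := hneigh (p + 1)
  omega

/-- The exponent vectors of an automorphism of `T_n`, `n ≥ 5`, that fixes the exponent vectors of
the first and the last generator, in terms of two parameters. -/
theorem exists_twinVec_map_eq {n : ℕ} (hn : 5 ≤ n) (f : MulAut (TwinGroup n))
    (h1 : twinVec (f (twinGen n 1)) = Pi.single 1 1)
    (hlast : twinVec (f (twinGen n (n - 1))) = Pi.single (n - 1) 1) :
    ∃ ε δ : ZMod 2, ∀ i, 1 ≤ i → i < n → twinVec (f (twinGen n i)) =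
      Pi.single i 1 + (if i = 3 then Pi.single 1 ε else 0) +
        (if i + 3 = n then Pi.single (n - 1) δ else 0) := by
  refine ⟨twinVec (f (twinGen n 3)) 1, twinVec (f (twinGen n (n - 3))) (n - 1), fun i hi hin => ?_⟩
  by_cases hi1 : i = 1
  · subst hi1
    rw [h1, if_neg (by omega), if_neg (by omega), add_zero, add_zero]
  by_cases hil : i = n - 1
  · subst hil
    rw [hlast, if_neg (by omega), if_neg (by omega), add_zero, add_zero]
  obtain ⟨hii, hsupp⟩ := twinVec_map_middle hn f h1 i (by omega) (by omega)
  funext p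
  by_cases hpi : p = i
  · subst hpi
    have a : p ≠ n - 1 := hil
    rw [hii]
    split_ifs <;> simp [hi1, a]
  by_cases hp1 : i = 3 ∧ p = 1
  · obtain ⟨rfl, rfl⟩ := hp1
    have a : 1 ≠ n - 1 := by omega
    rw [if_pos rfl]
    split_ifs <;> simp [a]
  by_cases hp2 : i + 3 = n ∧ p + 1 = n
  · obtain ⟨a, b⟩ := hp2
    have e1 : i = n - 3 := by omega
    have e2 : p = n - 1 := by omega
    have e3 : n - 1 ≠ i := by omega
    have e4 : n - 1 ≠ 1 := by omega
    have e5 : n - 1 ≠ n - 3 := by omega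
    rw [if_pos a, e2, e1]
    split_ifs <;> simp [e4, e5]
  have h0 : twinVec (f (twinGen n i)) p = 0 := by
    by_contra h
    have := hsupp p h
    tauto
  rw [h0, Pi.add_apply, Pi.add_apply, Pi.single_eq_of_ne hpi, zero_add]
  have a : (if i = 3 then (Pi.single 1 (twinVec (f (twinGen n 3)) 1) : ℕ → ZMod 2) else 0) p
      = 0 := by
    split_ifs with h
    · exact Pi.single_eq_of_ne (fun h' => hp1 ⟨h, h'⟩) _
    · rfl
  have b : (if i + 3 = n then (Pi.single (n - 1) (twinVec (f (twinGen n (n - 3))) (n - 1)) :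
      ℕ → ZMod 2) else 0) p = 0 := by
    split_ifs with h
    · exact Pi.single_eq_of_ne (by omega) _
    · rfl
  rw [a, b, add_zero]

/-! ### Semidirect products, cyclic and dihedral groups -/

/-- Both conclusions follow from a homomorphism `φ : D → Aut(G)` that induces an isomorphism
`D → Out(G)`, if `G` has trivial centre. -/
theorem autIsSemidirect_and_outIsRepresented {G D : Type*} [Group G] [Group D] (φ : D →* MulAut G)
    (hcenter : ∀ z : G, (∀ w, Commute z w) → z = 1) (hinj : ∀ d, φ d ∈ InnerAut G → d = 1)
    (hsurj : ∀ f, ∃ d, (φ d)⁻¹ * f ∈ InnerAut G) :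
    AutIsSemidirect G D φ.range ∧ OutIsRepresented G D φ.range := by
  have hconj : ∀ z : G, MulAut.conj z = 1 → z = 1 := fun z hz => hcenter z fun w => by
    have := DFunLike.congr_fun hz w
    rw [MulAut.conj_apply, MulAut.one_apply] at this
    exact mul_inv_eq_iff_eq_mul.1 this
  have hφ : Function.Injective φ :=
    (injective_iff_map_eq_one φ).2 fun d hd => hinj d (by rw [hd]; exact one_mem _)
  constructor
  · have hlift : ∀ d, MulAut.conj.comp (φ d).toMonoidHom =
        (MulAut.conj (φ d)).toMonoidHom.comp MulAut.conj := fun d => by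
      ext1 g
      ext1 x
      simp [MulAut.mul_apply, MulAut.conj_apply]
    let e : G ⋊[φ] D →* MulAut G := SemidirectProduct.lift MulAut.conj φ hlift
    have he : Function.Bijective e := by
      constructor
      · rw [injective_iff_map_eq_one]
        intro x hx
        rw [← SemidirectProduct.inl_left_mul_inr_right x, map_mul, SemidirectProduct.lift_inl,
          SemidirectProduct.lift_inr] at hx
        have hd : x.right = 1 := hinj _ (by
          rw [eq_inv_of_mul_eq_one_right hx]
          exact inv_mem (MonoidHom.mem_range.2 ⟨_, rfl⟩))
        rw [hd, map_one, mul_one] at hx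
        exact SemidirectProduct.ext (hconj _ hx) hd
      · intro f
        obtain ⟨d, g, hg⟩ := hsurj f
        refine ⟨SemidirectProduct.inr d * SemidirectProduct.inl g, ?_⟩
        rw [map_mul, SemidirectProduct.lift_inl, SemidirectProduct.lift_inr, hg,
          mul_inv_cancel_left]
    exact ⟨φ, MulEquiv.ofBijective e he, fun g => SemidirectProduct.lift_inl _ _ hlift g,
      fun d => SemidirectProduct.lift_inr _ _ hlift d, rfl⟩
  · let q : D →* OuterAut G := (QuotientGroup.mk' (InnerAut G)).comp φ
    have hq : Function.Bijective q := by
      constructor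
      · rw [injective_iff_map_eq_one]
        intro d hd
        exact hinj d ((QuotientGroup.eq_one_iff _).1 hd)
      · intro x
        obtain ⟨f, rfl⟩ := QuotientGroup.mk_surjective x
        obtain ⟨d, hd⟩ := hsurj f
        exact ⟨d, QuotientGroup.eq.2 hd⟩
    refine ⟨⟨(MulEquiv.ofBijective q hq).symm⟩, ⟨(MonoidHom.ofInjective hφ).symm⟩, ?_, ?_⟩
    · rw [injective_iff_map_eq_one]
      rintro ⟨_, d, rfl⟩ h
      have : d = 1 := hinj d ((QuotientGroup.eq_one_iff _).1 h)
      ext1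
      simp [this]
    · intro x
      obtain ⟨d, rfl⟩ := hq.2 x
      exact ⟨⟨φ d, d, rfl⟩, rfl⟩

theorem range_eq_closure_of_closure_eq_top {G H : Type*} [Group G] [Group H] (φ : G →* H)
    {S : Set G} (hS : Subgroup.closure S = ⊤) : φ.range = Subgroup.closure (φ '' S) := by
  rw [MonoidHom.range_eq_map, ← hS, MonoidHom.map_closure]

theorem pow_val_add {G : Type*} [Group G] {n : ℕ} [NeZero n] {x : G} (hx : x ^ n = 1)
    (i j : ZMod n) : x ^ (i + j).val = x ^ i.val * x ^ j.val := by
  rw [ZMod.val_add, ← pow_eq_pow_mod _ hx, pow_add]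

/-- The homomorphism from the cyclic group of order `n` given by an element with `x ^ n = 1`. -/
def cyclicLift {G : Type*} [Group G] {n : ℕ} [NeZero n] (x : G) (hx : x ^ n = 1) :
    Multiplicative (ZMod n) →* G where
  toFun i := x ^ (Multiplicative.toAdd i).val
  map_one' := by simp
  map_mul' i j := pow_val_add hx _ _

/-- The homomorphism from the dihedral group given by images of a rotation and a reflection which
satisfy the dihedral relations. -/
def dihedralLift {G : Type*} [Group G] {n : ℕ} [NeZero n] (x y : G) (hx : x ^ n = 1)
    (hy : y * y = 1) (hxy : y * x * y = x⁻¹) : DihedralGroup n →* G where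
  toFun
    | .r i => x ^ i.val
    | .sr i => y * x ^ i.val
  map_one' := by
    change x ^ (0 : ZMod n).val = 1
    simp
  map_mul' := by
    have hyinv : y⁻¹ = y := inv_eq_of_mul_eq_one_left hy
    have hpow : ∀ k : ℕ, x ^ k * y = y * (x ^ k)⁻¹ := fun k => by
      have h : y * x ^ k * y⁻¹ = (x ^ k)⁻¹ := by
        rw [← conj_pow, hyinv, hxy, inv_pow]
      rw [← h, hyinv, mul_assoc, ← mul_assoc y y, hy, one_mul]
    have hsub : ∀ i j : ZMod n, x ^ (j - i).val = (x ^ i.val)⁻¹ * x ^ j.val := fun i j => by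
      rw [eq_inv_mul_iff_mul_eq, ← pow_val_add hx, add_sub_cancel]
    rintro (i | i) (j | j)
    · rw [DihedralGroup.r_mul_r]
      exact pow_val_add hx _ _
    · rw [DihedralGroup.r_mul_sr]
      change y * x ^ (j - i).val = x ^ i.val * (y * x ^ j.val)
      rw [hsub, ← mul_assoc (x ^ i.val), hpow, mul_assoc]
    · rw [DihedralGroup.sr_mul_r]
      change y * x ^ (i + j).val = y * x ^ i.val * x ^ j.val
      rw [pow_val_add hx, mul_assoc]
    · rw [DihedralGroup.sr_mul_sr]
      change x ^ (j - i).val = y * x ^ i.val * (y * x ^ j.val)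
      rw [hsub, mul_assoc y, ← mul_assoc (x ^ i.val), hpow, mul_assoc, ← mul_assoc y, hy, one_mul]

/-! ### The automorphisms generating the outer automorphism group -/

theorem twinVec_map_congr {n : ℕ} (f : MulAut (TwinGroup n)) {x y : TwinGroup n}
    (h : twinVec x = twinVec y) : twinVec (f x) = twinVec (f y) := by
  rw [twinVec_map, twinVec_map f y, h]

theorem twinVec_of_mem_innerAut {n : ℕ} {f : MulAut (TwinGroup n)} (hf : f ∈ InnerAut (TwinGroup n))
    (x : TwinGroup n) : twinVec (f x) = twinVec x := by
  obtain ⟨g, rfl⟩ := hf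
  exact twinVec_conj g x

/-- The reversal `s_i ↦ s_{n-i}`, as a homomorphism. -/
def twinFlipHom (n : ℕ) : TwinGroup n →* TwinGroup n :=
  twinLift n (fun i => twinGen n (n - i)) (fun _ _ _ => twinGen_mul_self _ _)
    (fun _ _ _ _ _ => twinGen_comm (by omega))

theorem twinFlipHom_twinGen {n i : ℕ} (h1 : 1 ≤ i) (h2 : i < n) :
    twinFlipHom n (twinGen n i) = twinGen n (n - i) := twinLift_twinGen _ _ h1 h2

theorem twinFlipHom_comp_self (n : ℕ) : (twinFlipHom n).comp (twinFlipHom n) = MonoidHom.id _ := by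
  apply twin_hom_ext
  intro i h1 h2
  rw [MonoidHom.comp_apply, twinFlipHom_twinGen h1 h2, twinFlipHom_twinGen (by omega) (by omega)]
  simp only [MonoidHom.id_apply]
  congr 1
  omega

/-- The automorphism `ψ : s_i ↦ s_{n-i}`. -/
def twinFlip (n : ℕ) : MulAut (TwinGroup n) :=
  MonoidHom.toMulEquiv (twinFlipHom n) (twinFlipHom n) (twinFlipHom_comp_self n)
    (twinFlipHom_comp_self n)

theorem twinFlip_twinGen {n i : ℕ} (h1 : 1 ≤ i) (h2 : i < n) :
    twinFlip n (twinGen n i) = twinGen n (n - i) := twinFlipHom_twinGen h1 h2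

theorem twinFlip_mul_self (n : ℕ) : twinFlip n * twinFlip n = 1 :=
  MulEquiv.ext fun x => DFunLike.congr_fun (twinFlipHom_comp_self n) x

/-- The transvection `s_3 ↦ s_3 s_1` which fixes the other generators, as a homomorphism. -/
def twinTransvectionHom (n : ℕ) : TwinGroup n →* TwinGroup n :=
  twinLift n (fun i => if i = 3 then twinGen n 3 * twinGen n 1 else twinGen n i)
    (fun i _ _ => by
      split_ifs
      · rw [mul_assoc, ← mul_assoc (twinGen n 1), (twinGen_comm (n := n) (i := 1) (j := 3)
          (by omega)).eq, mul_assoc, twinGen_mul_self, mul_one, twinGen_mul_self]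
      · exact twinGen_mul_self _ _)
    (fun i j _ _ _ => by
      split_ifs with hi hj hj
      · omega
      · exact (twinGen_comm (by omega)).mul_left (twinGen_comm (by omega))
      · exact (twinGen_comm (by omega)).mul_right (twinGen_comm (by omega))
      · exact twinGen_comm (by omega))

theorem twinTransvectionHom_twinGen {n i : ℕ} (h1 : 1 ≤ i) (h2 : i < n) :
    twinTransvectionHom n (twinGen n i) =
      if i = 3 then twinGen n 3 * twinGen n 1 else twinGen n i := twinLift_twinGen _ _ h1 h2

theorem twinTransvectionHom_comp_self (n : ℕ) :
    (twinTransvectionHom n).comp (twinTransvectionHom n) = MonoidHom.id _ := by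
  apply twin_hom_ext
  intro i h1 h2
  rw [MonoidHom.comp_apply, twinTransvectionHom_twinGen h1 h2, MonoidHom.id_apply]
  split_ifs with hi
  · subst hi
    rw [map_mul, twinTransvectionHom_twinGen h1 h2, twinTransvectionHom_twinGen le_rfl (by omega),
      if_pos rfl, if_neg (by omega), mul_assoc, twinGen_mul_self, mul_one]
  · rw [twinTransvectionHom_twinGen h1 h2, if_neg hi]

/-- The automorphism `s_3 ↦ s_3 s_1` which fixes the other generators. -/
def twinTransvection (n : ℕ) : MulAut (TwinGroup n) :=
  MonoidHom.toMulEquiv (twinTransvectionHom n) (twinTransvectionHom n)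
    (twinTransvectionHom_comp_self n) (twinTransvectionHom_comp_self n)

theorem twinTransvection_twinGen {n i : ℕ} (h1 : 1 ≤ i) (h2 : i < n) :
    twinTransvection n (twinGen n i) =
      if i = 3 then twinGen n 3 * twinGen n 1 else twinGen n i := twinTransvectionHom_twinGen h1 h2

theorem twinTransvection_mul_self (n : ℕ) : twinTransvection n * twinTransvection n = 1 :=
  MulEquiv.ext fun x => DFunLike.congr_fun (twinTransvectionHom_comp_self n) x

/-! ### The case `n = 3` -/

theorem exists_cyclic_representative (f : MulAut (TwinGroup 3)) :
    (∀ i, 1 ≤ i → i < 3 → twinVec (f (twinGen 3 i)) = twinVec (twinGen 3 i)) ∨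
      ∀ i, 1 ≤ i → i < 3 → twinVec (f (twinGen 3 i)) = twinVec (twinFlip 3 (twinGen 3 i)) := by
  have h1 := twinVec_map_eq_zero_or f (i := 1) (j := 1) (p := 1) (q := 2) (by omega) (by omega)
    (by omega) (by omega)
  have h2 := twinVec_map_eq_zero_or f (i := 2) (j := 2) (p := 1) (q := 2) (by omega) (by omega)
    (by omega) (by omega)
  have hext : ∀ u v : ℕ → ZMod 2, (∀ p, ¬(1 ≤ p ∧ p < 3) → u p = 0) →
      (∀ p, ¬(1 ≤ p ∧ p < 3) → v p = 0) → u 1 = v 1 → u 2 = v 2 → u = v := by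
    intro u v hu hv e1 e2
    funext p
    by_cases hp : 1 ≤ p ∧ p < 3
    · obtain rfl | rfl : p = 1 ∨ p = 2 := by omega
      · exact e1
      · exact e2
    · rw [hu p hp, hv p hp]
  have hz : ∀ x : TwinGroup 3, ∀ p, ¬(1 ≤ p ∧ p < 3) → twinVec x p = 0 :=
    fun x p hp => twinVec_eq_zero_of_notMem x hp
  have hn1 : twinVec (f (twinGen 3 1)) 1 ≠ 0 ∨ twinVec (f (twinGen 3 1)) 2 ≠ 0 := by
    obtain ⟨p, hp, h⟩ := twinVec_map_twinGen_ne_zero f (i := 1) (by omega) (by omega)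
    obtain rfl | rfl : p = 1 ∨ p = 2 := by omega
    · exact Or.inl h
    · exact Or.inr h
  have hn2 : twinVec (f (twinGen 3 2)) 1 ≠ 0 ∨ twinVec (f (twinGen 3 2)) 2 ≠ 0 := by
    obtain ⟨p, hp, h⟩ := twinVec_map_twinGen_ne_zero f (i := 2) (by omega) (by omega)
    obtain rfl | rfl : p = 1 ∨ p = 2 := by omega
    · exact Or.inl h
    · exact Or.inr h
  have hne : twinVec (f (twinGen 3 1)) 1 ≠ twinVec (f (twinGen 3 2)) 1 ∨
      twinVec (f (twinGen 3 1)) 2 ≠ twinVec (f (twinGen 3 2)) 2 := by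
    obtain ⟨p, hp, h⟩ := twinVec_map_twinGen_ne f (i := 1) (j := 2) (by omega) (by omega) (by omega)
    obtain rfl | rfl : p = 1 ∨ p = 2 := by omega
    · exact Or.inl h
    · exact Or.inr h
  have hcases : (twinVec (f (twinGen 3 1)) 1 = 1 ∧ twinVec (f (twinGen 3 1)) 2 = 0 ∧
      twinVec (f (twinGen 3 2)) 1 = 0 ∧ twinVec (f (twinGen 3 2)) 2 = 1) ∨
      (twinVec (f (twinGen 3 1)) 1 = 0 ∧ twinVec (f (twinGen 3 1)) 2 = 1 ∧
      twinVec (f (twinGen 3 2)) 1 = 1 ∧ twinVec (f (twinGen 3 2)) 2 = 0) := by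
    generalize twinVec (f (twinGen 3 1)) 1 = a at *
    generalize twinVec (f (twinGen 3 1)) 2 = a' at *
    generalize twinVec (f (twinGen 3 2)) 1 = b at *
    generalize twinVec (f (twinGen 3 2)) 2 = b' at *
    revert a a' b b'
    decide
  rcases hcases with ⟨e1, e2, e3, e4⟩ | ⟨e1, e2, e3, e4⟩
  · left
    intro i hi1 hi2
    obtain rfl | rfl : i = 1 ∨ i = 2 := by omega
    · refine hext _ _ (hz _) (hz _) ?_ ?_ <;>
        rw [twinVec_twinGen (by omega) (by omega)] <;> simp [e1, e2]
    · refine hext _ _ (hz _) (hz _) ?_ ?_ <;>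
        rw [twinVec_twinGen (by omega) (by omega)] <;> simp [e3, e4]
  · right
    intro i hi1 hi2
    obtain rfl | rfl : i = 1 ∨ i = 2 := by omega
    · refine hext _ _ (hz _) (hz _) ?_ ?_ <;>
        rw [twinFlip_twinGen (by omega) (by omega), twinVec_twinGen (by omega) (by omega)] <;>
        simp [e1, e2]
    · refine hext _ _ (hz _) (hz _) ?_ ?_ <;>
        rw [twinFlip_twinGen (by omega) (by omega), twinVec_twinGen (by omega) (by omega)] <;>
        simp [e3, e4]

theorem twin_three : AutIsSemidirect (TwinGroup 3) (Multiplicative (ZMod 2))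
      (Subgroup.closure {twinFlip 3}) ∧
    OutIsRepresented (TwinGroup 3) (Multiplicative (ZMod 2)) (Subgroup.closure {twinFlip 3}) := by
  let φ : Multiplicative (ZMod 2) →* MulAut (TwinGroup 3) :=
    cyclicLift (twinFlip 3) (by rw [pow_two, twinFlip_mul_self])
  have hφ1 : φ (Multiplicative.ofAdd 1) = twinFlip 3 := pow_one _
  have htwo : ∀ d : Multiplicative (ZMod 2), d = 1 ∨ d = Multiplicative.ofAdd 1 := by decide
  have hrange : φ.range = Subgroup.closure {twinFlip 3} := by
    rw [range_eq_closure_of_closure_eq_top φ (S := {Multiplicative.ofAdd 1}), Set.image_singleton,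
      hφ1]
    rw [eq_top_iff]
    intro d _
    rcases htwo d with rfl | rfl
    · exact one_mem _
    · exact Subgroup.subset_closure rfl
  rw [← hrange]
  refine autIsSemidirect_and_outIsRepresented φ (fun z hz => twin_eq_one_of_central le_rfl hz) ?_ ?_
  · intro d hd
    rcases htwo d with rfl | rfl
    · rfl
    · exfalso
      rw [hφ1] at hd
      have := twinVec_of_mem_innerAut hd (twinGen 3 1)
      rw [twinFlip_twinGen (by omega) (by omega), twinVec_twinGen (by omega) (by omega),
        twinVec_twinGen (by omega) (by omega)] at this
      simpa using congrFun this 1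
  · intro f
    rcases exists_cyclic_representative f with h | h
    · exact ⟨1, inv_mul_mem_innerAut (h := φ 1) fun i h1 h2 => by rw [h i h1 h2, map_one]; rfl⟩
    · exact ⟨_, inv_mul_mem_innerAut (h := φ (Multiplicative.ofAdd 1)) fun i h1 h2 => by
        rw [h i h1 h2, hφ1]⟩

/-! ### The case `n = 4` -/

/-- The three involutions in the Klein four-group `⟨s_1, s_3⟩ ≤ T_4`. -/
def kleinInvolution (k : Fin 3) : TwinGroup 4 :=
  ![twinGen 4 1, twinGen 4 3, twinGen 4 1 * twinGen 4 3] k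

theorem kleinInvolution_commute (j k : Fin 3) :
    Commute (kleinInvolution j) (kleinInvolution k) := by
  have h : Commute (twinGen 4 1) (twinGen 4 3) := twinGen_comm (by omega)
  have hs1 := Commute.refl (twinGen 4 1)
  have hs3 := Commute.refl (twinGen 4 3)
  fin_cases j <;> fin_cases k
  · exact hs1
  · exact h
  · exact hs1.mul_right h
  · exact h.symm
  · exact hs3
  · exact h.symm.mul_right hs3
  · exact hs1.mul_left h.symm
  · exact h.mul_left hs3
  · exact Commute.refl _

theorem kleinInvolution_mul_self (k : Fin 3) : kleinInvolution k * kleinInvolution k = 1 := by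
  fin_cases k
  · exact twinGen_mul_self 4 1
  · exact twinGen_mul_self 4 3
  · have h : Commute (twinGen 4 1) (twinGen 4 3) := twinGen_comm (by omega)
    change twinGen 4 1 * twinGen 4 3 * (twinGen 4 1 * twinGen 4 3) = 1
    rw [h.symm.mul_mul_mul_comm, twinGen_mul_self, twinGen_mul_self, one_mul]

theorem kleinInvolution_mul {j k l : Fin 3} (hjk : j ≠ k) (hjl : j ≠ l) (hkl : k ≠ l) :
    kleinInvolution j * kleinInvolution k = kleinInvolution l := by
  have h012 : kleinInvolution 0 * kleinInvolution 1 = kleinInvolution 2 := rfl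
  have h120 : kleinInvolution 1 * kleinInvolution 2 = kleinInvolution 0 := by
    rw [← h012, (kleinInvolution_commute 0 1).eq, ← mul_assoc, kleinInvolution_mul_self, one_mul]
  have h021 : kleinInvolution 0 * kleinInvolution 2 = kleinInvolution 1 := by
    rw [← h012, ← mul_assoc, kleinInvolution_mul_self, one_mul]
  fin_cases j <;> fin_cases k <;> fin_cases l <;>
    first
      | exact absurd rfl hjk
      | exact absurd rfl hjl
      | exact absurd rfl hkl
      | exact h012
      | exact h120
      | exact h021
      | exact (kleinInvolution_commute 0 1).symm.eq.trans h012
      | exact (kleinInvolution_commute 1 2).symm.eq.trans h120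
      | exact (kleinInvolution_commute 0 2).symm.eq.trans h021

/-- The endomorphism of `T_4` that fixes `s_2` and permutes the involutions in `⟨s_1, s_3⟩`. -/
def kleinPermHom (σ : Equiv.Perm (Fin 3)) : TwinGroup 4 →* TwinGroup 4 :=
  twinLift 4 (fun i => if i = 1 then kleinInvolution (σ 0) else
      if i = 3 then kleinInvolution (σ 1) else twinGen 4 2)
    (fun i _ _ => by
      split_ifs
      · exact kleinInvolution_mul_self _
      · exact kleinInvolution_mul_self _
      · exact twinGen_mul_self _ _)
    (fun i j _ _ _ => by
      obtain ⟨rfl, rfl⟩ : i = 1 ∧ j = 3 := by omega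
      exact (kleinInvolution_commute _ _).eq)

theorem kleinPermHom_two (σ : Equiv.Perm (Fin 3)) : kleinPermHom σ (twinGen 4 2) = twinGen 4 2 := by
  rw [kleinPermHom, twinLift_twinGen _ _ (by omega) (by omega), if_neg (by omega),
    if_neg (by omega)]

theorem kleinPermHom_kleinInvolution (σ : Equiv.Perm (Fin 3)) (k : Fin 3) :
    kleinPermHom σ (kleinInvolution k) = kleinInvolution (σ k) := by
  have h0 : kleinPermHom σ (kleinInvolution 0) = kleinInvolution (σ 0) := by
    change kleinPermHom σ (twinGen 4 1) = _
    rw [kleinPermHom, twinLift_twinGen _ _ (by omega) (by omega), if_pos rfl]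
  have h1 : kleinPermHom σ (kleinInvolution 1) = kleinInvolution (σ 1) := by
    change kleinPermHom σ (twinGen 4 3) = _
    rw [kleinPermHom, twinLift_twinGen _ _ (by omega) (by omega), if_neg (by omega), if_pos rfl]
  fin_cases k
  · exact h0
  · exact h1
  · change kleinPermHom σ (kleinInvolution 0 * kleinInvolution 1) = kleinInvolution (σ 2)
    rw [map_mul, h0, h1]
    exact kleinInvolution_mul (σ.injective.ne (by decide)) (σ.injective.ne (by decide))
      (σ.injective.ne (by decide))

theorem twin_four_hom_ext {G : Type*} [Group G] {f g : TwinGroup 4 →* G}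
    (h0 : f (kleinInvolution 0) = g (kleinInvolution 0))
    (h1 : f (kleinInvolution 1) = g (kleinInvolution 1))
    (h2 : f (twinGen 4 2) = g (twinGen 4 2)) : f = g := by
  apply twin_hom_ext
  intro i hi1 hi2
  obtain rfl | rfl | rfl : i = 1 ∨ i = 2 ∨ i = 3 := by omega
  · exact h0
  · exact h2
  · exact h1

theorem kleinPermHom_comp (σ τ : Equiv.Perm (Fin 3)) :
    (kleinPermHom σ).comp (kleinPermHom τ) = kleinPermHom (σ * τ) := by
  apply twin_four_hom_ext <;>
    simp [kleinPermHom_kleinInvolution, kleinPermHom_two]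

theorem kleinPermHom_one : kleinPermHom 1 = MonoidHom.id _ := by
  apply twin_four_hom_ext <;>
    simp [kleinPermHom_kleinInvolution, kleinPermHom_two]

/-- The action of `S_3` on `T_4`, by permutation of the involutions in `⟨s_1, s_3⟩`. -/
def kleinPerm : Equiv.Perm (Fin 3) →* MulAut (TwinGroup 4) where
  toFun σ := MonoidHom.toMulEquiv (kleinPermHom σ) (kleinPermHom σ⁻¹)
    (by rw [kleinPermHom_comp, inv_mul_cancel, kleinPermHom_one])
    (by rw [kleinPermHom_comp, mul_inv_cancel, kleinPermHom_one])
  map_one' := MulEquiv.ext fun x => DFunLike.congr_fun kleinPermHom_one x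
  map_mul' σ τ := MulEquiv.ext fun x => (DFunLike.congr_fun (kleinPermHom_comp σ τ) x).symm

theorem kleinPerm_two (σ : Equiv.Perm (Fin 3)) : kleinPerm σ (twinGen 4 2) = twinGen 4 2 :=
  kleinPermHom_two σ

theorem kleinPerm_one (σ : Equiv.Perm (Fin 3)) :
    kleinPerm σ (twinGen 4 1) = kleinInvolution (σ 0) := kleinPermHom_kleinInvolution σ 0

theorem kleinPerm_three (σ : Equiv.Perm (Fin 3)) :
    kleinPerm σ (twinGen 4 3) = kleinInvolution (σ 1) := kleinPermHom_kleinInvolution σ 1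

/-- The exponents of `s_1` and `s_3` in the three involutions. -/
def kleinExponents (k : Fin 3) : ZMod 2 × ZMod 2 := ![(1, 0), (0, 1), (1, 1)] k

theorem twinVec_kleinInvolution (k : Fin 3) : twinVec (kleinInvolution k) =
    Pi.single 1 (kleinExponents k).1 + Pi.single 3 (kleinExponents k).2 := by
  have h1 : twinVec (twinGen 4 1) = Pi.single 1 1 := twinVec_twinGen (by omega) (by omega)
  have h3 : twinVec (twinGen 4 3) = Pi.single 3 1 := twinVec_twinGen (by omega) (by omega)
  fin_cases k
  · change twinVec (twinGen 4 1) = Pi.single 1 1 + Pi.single 3 0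
    rw [h1, Pi.single_zero, add_zero]
  · change twinVec (twinGen 4 3) = Pi.single 1 0 + Pi.single 3 1
    rw [h3, Pi.single_zero, zero_add]
  · change twinVec (twinGen 4 1 * twinGen 4 3) = Pi.single 1 1 + Pi.single 3 1
    rw [twinVec_mul, h1, h3]

theorem exists_index_of_exponents : ∀ a a' : ZMod 2, (a, a') ≠ (0, 0) →
    ∃ k, kleinExponents k = (a, a') := by
  decide

theorem exists_perm_fin_three : ∀ j k : Fin 3, j ≠ k →
    ∃ σ : Equiv.Perm (Fin 3), σ 0 = j ∧ σ 1 = k := by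
  decide

theorem exists_perm_of_exponents {a a' b b' : ZMod 2} (ha : (a, a') ≠ (0, 0))
    (hb : (b, b') ≠ (0, 0)) (hab : (a, a') ≠ (b, b')) : ∃ σ : Equiv.Perm (Fin 3),
      kleinExponents (σ 0) = (a, a') ∧ kleinExponents (σ 1) = (b, b') := by
  obtain ⟨j, hj⟩ := exists_index_of_exponents a a' ha
  obtain ⟨k, hk⟩ := exists_index_of_exponents b b' hb
  obtain ⟨σ, h0, h1⟩ := exists_perm_fin_three j k fun h => hab (by rw [← hj, ← hk, h])
  exact ⟨σ, by rw [h0, hj], by rw [h1, hk]⟩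

theorem perm_eq_one_of_exponents : ∀ σ : Equiv.Perm (Fin 3),
    kleinExponents (σ 0) = kleinExponents 0 → kleinExponents (σ 1) = kleinExponents 1 → σ = 1 := by
  decide

theorem exists_perm_representative (f : MulAut (TwinGroup 4)) :
    ∃ σ, ∀ i, 1 ≤ i → i < 4 →
      twinVec (f (twinGen 4 i)) = twinVec (kleinPerm σ (twinGen 4 i)) := by
  have hodd : ∀ i, i = 1 ∨ i = 3 → twinVec (f (twinGen 4 i)) 2 = 0 := by
    intro i hi
    by_contra h
    exact not_two_neighbours f (i := i) (i' := 2) (p := 2) (q := 1) (p' := 2) (q' := 3) (by omega)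
      (by omega) (by omega) (by omega) (by omega) (by omega) (by omega) (by omega) h h
  have htwo : twinVec (f (twinGen 4 2)) 2 = 1 :=
    twinVec_map_eq_one f (by omega) fun j h1 h2 h3 => hodd j (by omega)
  have hvec : ∀ i, i = 1 ∨ i = 3 → twinVec (f (twinGen 4 i)) =
      Pi.single 1 (twinVec (f (twinGen 4 i)) 1) + Pi.single 3 (twinVec (f (twinGen 4 i)) 3) := by
    intro i hi
    funext p
    by_cases hp : 1 ≤ p ∧ p < 4
    · obtain rfl | rfl | rfl : p = 1 ∨ p = 2 ∨ p = 3 := by omega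
      · simp
      · rw [hodd i hi]; simp
      · simp
    · have h1 : p ≠ 1 := by omega
      have h3 : p ≠ 3 := by omega
      rw [twinVec_eq_zero_of_notMem _ hp]
      simp [h1, h3]
  have hne : ∀ i, i = 1 ∨ i = 3 →
      (twinVec (f (twinGen 4 i)) 1, twinVec (f (twinGen 4 i)) 3) ≠ 0 := by
    intro i hi h
    obtain ⟨p, hp, hp0⟩ := twinVec_map_twinGen_ne_zero f (i := i) (by omega) (by omega)
    rw [Prod.mk_eq_zero] at h
    rw [hvec i hi, h.1, h.2] at hp0
    simp at hp0
  have hne' : (twinVec (f (twinGen 4 1)) 1, twinVec (f (twinGen 4 1)) 3) ≠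
      (twinVec (f (twinGen 4 3)) 1, twinVec (f (twinGen 4 3)) 3) := by
    intro h
    obtain ⟨p, hp, hp0⟩ := twinVec_map_twinGen_ne f (i := 1) (j := 3) (by omega) (by omega)
      (by omega)
    rw [Prod.mk.injEq] at h
    apply hp0
    rw [hvec 1 (Or.inl rfl), hvec 3 (Or.inr rfl), h.1, h.2]
  obtain ⟨σ, hσ0, hσ1⟩ := exists_perm_of_exponents (hne 1 (Or.inl rfl)) (hne 3 (Or.inr rfl))
    hne'
  refine ⟨σ, fun i hi1 hi2 => ?_⟩
  obtain rfl | rfl | rfl : i = 1 ∨ i = 2 ∨ i = 3 := by omega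
  · rw [kleinPerm_one, twinVec_kleinInvolution, hσ0]
    exact hvec 1 (Or.inl rfl)
  · rw [kleinPerm_two, twinVec_twinGen (by omega) (by omega)]
    have hself : ∀ q, 1 ≤ q ∧ q < 4 → (2 + 1 = q ∨ q + 1 = 2) →
        twinVec (f (twinGen 4 2)) q = 0 := fun q hq h2q =>
      (twinVec_map_eq_zero_or f (i := 2) (j := 2) (p := 2) (q := q) (by omega) (by omega) hq
        h2q).resolve_left (by rw [htwo]; exact one_ne_zero)
    funext p
    by_cases hp : 1 ≤ p ∧ p < 4
    · by_cases hp2 : p = 2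
      · rw [hp2, htwo]; simp
      · rw [hself p hp (by omega), Pi.single_eq_of_ne hp2]
    · rw [twinVec_eq_zero_of_notMem _ hp, Pi.single_eq_of_ne (by omega)]
  · rw [kleinPerm_three, twinVec_kleinInvolution, hσ1]
    exact hvec 3 (Or.inr rfl)

theorem perm_fin_three_generators : ∀ σ : Equiv.Perm (Fin 3), ∃ i : Fin 2, ∃ j : Fin 3,
    σ = Equiv.swap 0 1 ^ (i : ℕ) * (finRotate 3)⁻¹ ^ (j : ℕ) := by
  decide

theorem closure_perm_fin_three :
    Subgroup.closure {Equiv.swap 0 1, (finRotate 3)⁻¹} = (⊤ : Subgroup (Equiv.Perm (Fin 3))) := by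
  rw [eq_top_iff]
  intro σ _
  obtain ⟨i, j, h⟩ := perm_fin_three_generators σ
  rw [h]
  exact mul_mem (pow_mem (Subgroup.subset_closure (by simp)) _)
    (pow_mem (Subgroup.subset_closure (by simp)) _)

theorem twin_four : AutIsSemidirect (TwinGroup 4) (Equiv.Perm (Fin 3))
      (Subgroup.closure {kleinPerm (Equiv.swap 0 1), kleinPerm (finRotate 3)⁻¹}) ∧
    OutIsRepresented (TwinGroup 4) (Equiv.Perm (Fin 3))
      (Subgroup.closure {kleinPerm (Equiv.swap 0 1), kleinPerm (finRotate 3)⁻¹}) := by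
  have hrange := range_eq_closure_of_closure_eq_top kleinPerm closure_perm_fin_three
  rw [Set.image_pair] at hrange
  rw [← hrange]
  refine autIsSemidirect_and_outIsRepresented kleinPerm
    (fun z hz => twin_eq_one_of_central (by omega) hz) (fun σ hσ => ?_) fun f => ?_
  · have h : ∀ j k, twinVec (kleinInvolution j) = twinVec (kleinInvolution k) →
        kleinExponents j = kleinExponents k := by
      intro j k hjk
      rw [twinVec_kleinInvolution, twinVec_kleinInvolution] at hjk
      have e1 := congrFun hjk 1
      have e3 := congrFun hjk 3
      exact Prod.ext (by simpa using e1) (by simpa using e3)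
    refine perm_eq_one_of_exponents σ (h _ _ ?_) (h _ _ ?_)
    · rw [← kleinPerm_one]; exact twinVec_of_mem_innerAut hσ _
    · rw [← kleinPerm_three]; exact twinVec_of_mem_innerAut hσ _
  · obtain ⟨σ, hσ⟩ := exists_perm_representative f
    exact ⟨σ, inv_mul_mem_innerAut hσ⟩

/-! ### The case `n ≥ 5` -/

/-- The automorphism `s_{n-3} ↦ s_{n-3} s_{n-1}` which fixes the other generators: the mirror image
of `twinTransvection`. -/
def twinTransvection' (n : ℕ) : MulAut (TwinGroup n) :=
  twinFlip n * twinTransvection n * twinFlip n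

theorem twinTransvection'_twinGen {n i : ℕ} (h1 : 1 ≤ i) (h2 : i < n) :
    twinTransvection' n (twinGen n i) =
      if i + 3 = n then twinGen n i * twinGen n (n - 1) else twinGen n i := by
  rw [twinTransvection', MulAut.mul_apply, MulAut.mul_apply, twinFlip_twinGen h1 h2,
    twinTransvection_twinGen (by omega) (by omega)]
  have e : n - (n - i) = i := by omega
  split_ifs with h h' h'
  · rw [map_mul, twinFlip_twinGen (by omega) (by omega), twinFlip_twinGen (by omega) (by omega),
      ← h, e]
  · omega
  · omega
  · rw [twinFlip_twinGen (by omega) (by omega), e]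

theorem twinTransvection_commute {n : ℕ} (hn : 5 ≤ n) :
    twinTransvection n * twinTransvection' n = twinTransvection' n * twinTransvection n := by
  refine twin_aut_ext fun i h1 h2 => ?_
  rw [MulAut.mul_apply, MulAut.mul_apply, twinTransvection_twinGen h1 h2,
    twinTransvection'_twinGen h1 h2]
  have e1 : twinTransvection' n (twinGen n 1) = twinGen n 1 := by
    rw [twinTransvection'_twinGen le_rfl (by omega), if_neg (by omega)]
  have e2 : twinTransvection n (twinGen n (n - 1)) = twinGen n (n - 1) := by
    rw [twinTransvection_twinGen (by omega) (by omega), if_neg (by omega)]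
  have hc : Commute (twinGen n 1) (twinGen n (n - 1)) := twinGen_comm (by omega)
  by_cases h3 : i = 3
  · subst h3
    rw [if_pos rfl, map_mul, e1, twinTransvection'_twinGen h1 h2]
    split_ifs
    · rw [map_mul, e2, twinTransvection_twinGen h1 h2, if_pos rfl, mul_assoc, hc.eq, mul_assoc]
    · rw [twinTransvection_twinGen h1 h2, if_pos rfl]
  · rw [if_neg h3, twinTransvection'_twinGen h1 h2]
    split_ifs
    · rw [map_mul, e2, twinTransvection_twinGen h1 h2, if_neg h3]
    · rw [twinTransvection_twinGen h1 h2, if_neg h3]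

/-- The automorphism `κ`, of order four. -/
def twinRotation (n : ℕ) : MulAut (TwinGroup n) := twinFlip n * twinTransvection n

theorem twinRotation_three {n : ℕ} (hn : 5 ≤ n) :
    twinRotation n (twinGen n 3) = twinGen n (n - 3) * twinGen n (n - 1) := by
  rw [twinRotation, MulAut.mul_apply, twinTransvection_twinGen (by omega) (by omega), if_pos rfl,
    map_mul, twinFlip_twinGen (by omega) (by omega), twinFlip_twinGen (by omega) (by omega)]

theorem twinRotation_of_ne {n i : ℕ} (h1 : 1 ≤ i) (h2 : i < n) (h3 : i ≠ 3) :
    twinRotation n (twinGen n i) = twinGen n (n - i) := by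
  rw [twinRotation, MulAut.mul_apply, twinTransvection_twinGen h1 h2, if_neg h3,
    twinFlip_twinGen h1 h2]

theorem twinRotation_sq (n : ℕ) :
    twinRotation n ^ 2 = twinTransvection' n * twinTransvection n := by
  rw [pow_two, twinRotation, twinTransvection']
  group

theorem twinTransvection'_mul_self (n : ℕ) : twinTransvection' n * twinTransvection' n = 1 := by
  have h := twinFlip_mul_self n
  have h' := twinTransvection_mul_self n
  calc twinTransvection' n * twinTransvection' n = twinFlip n * (twinTransvection n *
        (twinFlip n * twinFlip n) * twinTransvection n) * twinFlip n := by
        rw [twinTransvection']; group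
    _ = 1 := by rw [h, mul_one, h', mul_one, h]

theorem twinRotation_pow_four {n : ℕ} (hn : 5 ≤ n) : twinRotation n ^ 4 = 1 := by
  have h : twinRotation n ^ 4 = (twinRotation n ^ 2) * (twinRotation n ^ 2) := by group
  rw [h, twinRotation_sq]
  nth_rw 1 [← twinTransvection_commute hn]
  rw [mul_assoc, ← mul_assoc (twinTransvection' n), twinTransvection'_mul_self, one_mul,
    twinTransvection_mul_self]

theorem twinFlip_conj_twinRotation (n : ℕ) :
    twinFlip n * twinRotation n * twinFlip n = (twinRotation n)⁻¹ := by
  rw [eq_inv_iff_mul_eq_one, twinRotation]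
  have h := twinFlip_mul_self n
  have h' := twinTransvection_mul_self n
  calc twinFlip n * (twinFlip n * twinTransvection n) * twinFlip n *
        (twinFlip n * twinTransvection n) = (twinFlip n * twinFlip n) * twinTransvection n *
        (twinFlip n * twinFlip n) * twinTransvection n := by group
    _ = 1 := by rw [h, mul_one, one_mul, h']

/-- The action of the dihedral group of order 8 on `T_n`. -/
def twinDihedral {n : ℕ} (hn : 5 ≤ n) : DihedralGroup 4 →* MulAut (TwinGroup n) :=
  dihedralLift (twinRotation n) (twinFlip n) (twinRotation_pow_four hn) (twinFlip_mul_self n)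
    (twinFlip_conj_twinRotation n)

theorem twinDihedral_sr_zero {n : ℕ} (hn : 5 ≤ n) : twinDihedral hn (.sr 0) = twinFlip n :=
  mul_one _

theorem twinDihedral_r_one {n : ℕ} (hn : 5 ≤ n) : twinDihedral hn (.r 1) = twinRotation n :=
  pow_one _

theorem twinDihedral_sr_one {n : ℕ} (hn : 5 ≤ n) :
    twinDihedral hn (.sr 1) = twinTransvection n := by
  change twinFlip n * twinRotation n ^ 1 = _
  rw [pow_one, twinRotation, ← mul_assoc, twinFlip_mul_self, one_mul]

theorem twinDihedral_sr_three {n : ℕ} (hn : 5 ≤ n) :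
    twinDihedral hn (.sr 3) = twinTransvection' n := by
  have : (DihedralGroup.sr 3 : DihedralGroup 4) = .sr 0 * .sr 1 * .sr 0 := by decide
  rw [this, map_mul, map_mul, twinDihedral_sr_zero, twinDihedral_sr_one, twinTransvection']

theorem closure_dihedral_four :
    Subgroup.closure {.sr 0, .r 1} = (⊤ : Subgroup (DihedralGroup 4)) := by
  have h0 : DihedralGroup.sr 0 ∈
      Subgroup.closure ({.sr 0, .r 1} : Set (DihedralGroup 4)) :=
    Subgroup.subset_closure (Set.mem_insert _ _)
  have h1 : DihedralGroup.r 1 ∈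
      Subgroup.closure ({.sr 0, .r 1} : Set (DihedralGroup 4)) :=
    Subgroup.subset_closure (Set.mem_insert_of_mem _ rfl)
  have hr (k : ZMod 4) : DihedralGroup.r k ∈
      Subgroup.closure ({.sr 0, .r 1} : Set (DihedralGroup 4)) := by
    have h : DihedralGroup.r k = .r 1 ^ k.val := by
      rw [DihedralGroup.r_one_pow, ZMod.natCast_val, ZMod.cast_id]
    rw [h]
    exact Subgroup.pow_mem _ h1 _
  rw [eq_top_iff]
  rintro (k | k) _
  · exact hr k
  · have : DihedralGroup.sr k = .sr 0 * .r k := by rw [DihedralGroup.sr_mul_r, zero_add]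
    rw [this]
    exact Subgroup.mul_mem _ h0 (hr k)

/-- In the dihedral group of order 8, the central rotation lies in every nontrivial normal
subgroup. -/
theorem dihedral_central_rotation_of_ne_one {K : Subgroup (DihedralGroup 4)} [K.Normal]
    {d : DihedralGroup 4} (hd : d ∈ K) (h1 : d ≠ 1) : .r 2 ∈ K := by
  rcases d with k | k
  · have : k = 2 ∨ k + k = 2 ∨ k = 0 := by
      clear hd h1
      revert k
      decide
    rcases this with rfl | h | rfl
    · exact hd
    · rw [← h, ← DihedralGroup.r_mul_r]
      exact mul_mem hd hd
    · exact absurd rfl h1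
  · have hc : DihedralGroup.r 2 = .sr k * (.r 1 * .sr k * (.r 1)⁻¹) := by
      clear hd h1
      revert k
      decide
    rw [hc]
    exact mul_mem hd (Subgroup.Normal.conj_mem inferInstance _ hd _)

theorem twinVec_transvection {n i : ℕ} (h1 : 1 ≤ i) (h2 : i < n) :
    twinVec (twinTransvection n (twinGen n i)) =
      Pi.single i 1 + if i = 3 then Pi.single 1 1 else 0 := by
  rw [twinTransvection_twinGen h1 h2]
  split_ifs with h
  · rw [twinVec_mul, twinVec_twinGen (by omega) (by omega), twinVec_twinGen (by omega) (by omega),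
      h]
  · rw [twinVec_twinGen h1 h2, add_zero]

theorem twinVec_transvection' {n i : ℕ} (h1 : 1 ≤ i) (h2 : i < n) :
    twinVec (twinTransvection' n (twinGen n i)) =
      Pi.single i 1 + if i + 3 = n then Pi.single (n - 1) 1 else 0 := by
  rw [twinTransvection'_twinGen h1 h2]
  split_ifs with h
  · rw [twinVec_mul, twinVec_twinGen h1 h2, twinVec_twinGen (by omega) (by omega)]
  · rw [twinVec_twinGen h1 h2, add_zero]

theorem twinVec_transvection_mul {n i : ℕ} (hn : 5 ≤ n) (h1 : 1 ≤ i) (h2 : i < n) :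
    twinVec ((twinTransvection n * twinTransvection' n) (twinGen n i)) =
      Pi.single i 1 + (if i = 3 then Pi.single 1 1 else 0) +
        if i + 3 = n then Pi.single (n - 1) 1 else 0 := by
  rw [MulAut.mul_apply, twinTransvection'_twinGen h1 h2]
  split_ifs with h h' h'
  · rw [map_mul, twinVec_mul, twinVec_transvection h1 h2,
      twinVec_transvection (by omega) (by omega), if_pos h', if_neg (by omega : n - 1 ≠ 3),
      add_zero]
  · rw [map_mul, twinVec_mul, twinVec_transvection h1 h2,
      twinVec_transvection (by omega) (by omega), if_neg h', if_neg (by omega : n - 1 ≠ 3),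
      add_zero, add_zero]
  · rw [twinVec_transvection h1 h2, if_pos h', add_zero]
  · rw [twinVec_transvection h1 h2, if_neg h', add_zero, add_zero]

/-- The four possible values of the two parameters are realized by the four elements `1`, `sr 1`,
`sr 3` and `r 2 = sr 1 * sr 3`. -/
theorem exists_dihedral_representative_of_fix {n : ℕ} (hn : 5 ≤ n) (f : MulAut (TwinGroup n))
    (h1 : twinVec (f (twinGen n 1)) = Pi.single 1 1)
    (hlast : twinVec (f (twinGen n (n - 1))) = Pi.single (n - 1) 1) :
    ∃ d, (twinDihedral hn d)⁻¹ * f ∈ InnerAut (TwinGroup n) := by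
  obtain ⟨ε, δ, h⟩ := exists_twinVec_map_eq hn f h1 hlast
  have hzmod : ∀ a : ZMod 2, a = 0 ∨ a = 1 := by decide
  rcases hzmod ε with rfl | rfl <;> rcases hzmod δ with rfl | rfl
  · refine ⟨1, inv_mul_mem_innerAut fun i hi1 hi2 => ?_⟩
    rw [h i hi1 hi2, map_one, MulAut.one_apply, twinVec_twinGen hi1 hi2]
    simp
  · refine ⟨.sr 3, inv_mul_mem_innerAut fun i hi1 hi2 => ?_⟩
    rw [h i hi1 hi2, twinDihedral_sr_three, twinVec_transvection' hi1 hi2]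
    simp
  · refine ⟨.sr 1, inv_mul_mem_innerAut fun i hi1 hi2 => ?_⟩
    rw [h i hi1 hi2, twinDihedral_sr_one, twinVec_transvection hi1 hi2]
    simp
  · refine ⟨.sr 1 * .sr 3, inv_mul_mem_innerAut fun i hi1 hi2 => ?_⟩
    rw [h i hi1 hi2, map_mul, twinDihedral_sr_one, twinDihedral_sr_three,
      twinVec_transvection_mul hn hi1 hi2]

/-- The flip reduces to the case that the exponent vectors of the first and the last generator are
preserved. -/
theorem exists_dihedral_representative {n : ℕ} (hn : 5 ≤ n) (f : MulAut (TwinGroup n)) :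
    ∃ d, (twinDihedral hn d)⁻¹ * f ∈ InnerAut (TwinGroup n) := by
  have hne : twinVec (f (twinGen n 1)) ≠ twinVec (f (twinGen n (n - 1))) := by
    obtain ⟨p, _, hp⟩ := twinVec_map_twinGen_ne f (i := 1) (j := n - 1) (by omega) (by omega)
      (by omega)
    exact fun h => hp (congrFun h p)
  rcases twinVec_map_end hn f (i := 1) (Or.inl rfl) with h1 | h1
  · refine exists_dihedral_representative_of_fix hn f h1 ?_
    exact (twinVec_map_end hn f (i := n - 1) (by omega)).resolve_left fun h => hne (by rw [h1, h])
  · have hl : twinVec (f (twinGen n (n - 1))) = Pi.single 1 1 :=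
      (twinVec_map_end hn f (i := n - 1) (by omega)).resolve_right fun h => hne (by rw [h1, h])
    obtain ⟨d, hd⟩ := exists_dihedral_representative_of_fix hn (twinFlip n * f) (by
        rw [MulAut.mul_apply, twinVec_map_congr (twinFlip n) (y := twinGen n (n - 1)),
          twinFlip_twinGen (by omega) (by omega), twinVec_twinGen (by omega) (by omega)]
        · congr 1; omega
        · rw [h1, twinVec_twinGen (by omega) (by omega)]) (by
        rw [MulAut.mul_apply, twinVec_map_congr (twinFlip n) (y := twinGen n 1),
          twinFlip_twinGen (by omega) (by omega), twinVec_twinGen (by omega) (by omega)]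
        rw [hl, twinVec_twinGen (by omega) (by omega)])
    refine ⟨.sr 0 * d, ?_⟩
    have hflip : (twinFlip n)⁻¹ = twinFlip n := inv_eq_of_mul_eq_one_left (twinFlip_mul_self n)
    rw [map_mul, mul_inv_rev, twinDihedral_sr_zero, hflip, mul_assoc]
    exact hd

theorem twinDihedral_central_rotation_notMem {n : ℕ} (hn : 5 ≤ n) :
    twinDihedral hn (.r 2) ∉ InnerAut (TwinGroup n) := by
  intro h
  have e : (DihedralGroup.r 2 : DihedralGroup 4) = .sr 1 * .sr 3 := by decide
  have h3 := twinVec_of_mem_innerAut h (twinGen n 3)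
  rw [e, map_mul, twinDihedral_sr_one, twinDihedral_sr_three,
    twinVec_transvection_mul hn (by omega) (by omega), twinVec_twinGen (by omega) (by omega)] at h3
  have h4 := congrFun h3 1
  have hn1 : 1 ≠ n - 1 := by omega
  rw [if_pos rfl] at h4
  split_ifs at h4 <;> simp [hn1] at h4

theorem twin_five {n : ℕ} (hn : 5 ≤ n) : AutIsSemidirect (TwinGroup n) (DihedralGroup 4)
      (Subgroup.closure {twinFlip n, twinRotation n}) ∧
    OutIsRepresented (TwinGroup n) (DihedralGroup 4)
      (Subgroup.closure {twinFlip n, twinRotation n}) := by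
  have hrange := range_eq_closure_of_closure_eq_top (twinDihedral hn) closure_dihedral_four
  rw [Set.image_pair, twinDihedral_sr_zero, twinDihedral_r_one] at hrange
  rw [← hrange]
  refine autIsSemidirect_and_outIsRepresented (twinDihedral hn)
    (fun z hz => twin_eq_one_of_central (by omega) hz) (fun d hd => ?_)
    (exists_dihedral_representative hn)
  by_contra hne
  exact twinDihedral_central_rotation_notMem hn (dihedral_central_rotation_of_ne_one
    (K := (InnerAut (TwinGroup n)).comap (twinDihedral hn)) hd hne)

theorem theorem5p1 :
    -- an automorphism is inner iff it sends each generator into its own conjugacy class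
    (∀ n : ℕ, 3 ≤ n → ∀ f : MulAut (TwinGroup n),
      f ∈ InnerAut (TwinGroup n) ↔
        ∀ i : ℕ, 1 ≤ i → i < n → IsConj (twinGen n i) (f (twinGen n i))) ∧
    -- the case n = 3
    (∃ ψ : MulAut (TwinGroup 3),
      (∀ i : ℕ, 1 ≤ i → i < 3 → ψ (twinGen 3 i) = twinGen 3 (3 - i)) ∧
      AutIsSemidirect (TwinGroup 3) (Multiplicative (ZMod 2)) (Subgroup.closure {ψ}) ∧
      OutIsRepresented (TwinGroup 3) (Multiplicative (ZMod 2)) (Subgroup.closure {ψ})) ∧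
    -- the case n = 4
    (∃ ψ τ : MulAut (TwinGroup 4),
      (∀ i : ℕ, 1 ≤ i → i < 4 → ψ (twinGen 4 i) = twinGen 4 (4 - i)) ∧
      (τ (twinGen 4 1) = twinGen 4 1 * twinGen 4 3 ∧
        τ (twinGen 4 2) = twinGen 4 2 ∧
        τ (twinGen 4 3) = twinGen 4 1) ∧
      AutIsSemidirect (TwinGroup 4) (Equiv.Perm (Fin 3)) (Subgroup.closure {ψ, τ}) ∧
      OutIsRepresented (TwinGroup 4) (Equiv.Perm (Fin 3)) (Subgroup.closure {ψ, τ})) ∧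
    -- the case n ≥ 5
    (∀ n : ℕ, 5 ≤ n → ∃ ψ κ : MulAut (TwinGroup n),
      (∀ i : ℕ, 1 ≤ i → i < n → ψ (twinGen n i) = twinGen n (n - i)) ∧
      (κ (twinGen n 3) = twinGen n (n - 3) * twinGen n (n - 1) ∧
        ∀ i : ℕ, 1 ≤ i → i < n → i ≠ 3 → κ (twinGen n i) = twinGen n (n - i)) ∧
      AutIsSemidirect (TwinGroup n) (DihedralGroup 4) (Subgroup.closure {ψ, κ}) ∧
      OutIsRepresented (TwinGroup n) (DihedralGroup 4) (Subgroup.closure {ψ, κ})) := by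
  refine ⟨fun n _ f => ⟨?_, fun hf => ClassPreserving.mem_innerAut hf⟩,
    ⟨twinFlip 3, fun i h1 h2 => twinFlip_twinGen h1 h2, twin_three⟩,
    ⟨kleinPerm (Equiv.swap 0 1), kleinPerm (finRotate 3)⁻¹, ?_, ⟨?_, kleinPerm_two _, ?_⟩,
      twin_four⟩,
    fun n hn => ⟨twinFlip n, twinRotation n, fun i h1 h2 => twinFlip_twinGen h1 h2,
      ⟨twinRotation_three hn, fun i h1 h2 h3 => twinRotation_of_ne h1 h2 h3⟩, twin_five hn⟩⟩
  · rintro ⟨g, rfl⟩ i _ _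
    exact isConj_iff.2 ⟨g, rfl⟩
  · intro i h1 h2
    obtain rfl | rfl | rfl : i = 1 ∨ i = 2 ∨ i = 3 := by omega
    · rw [kleinPerm_one]; rfl
    · exact kleinPerm_two _
    · rw [kleinPerm_three]; rfl
  · rw [kleinPerm_one]; rfl
  · rw [kleinPerm_three]; rfl
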